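/- Fix an integer $q$ and a real $0\le\beta<1$. For an integer $k\ge0$ let $$\delta(k)=\begin{cases}\dfrac{2(1-\beta)}{q-1-(1-\beta)k} & \text{if } k\le \frac{q-1}{1-\beta}-2,\\[2mm] 1 & \text{otherwise.}\end{cases}$$ For a finite graph $G=(V,E)$, $v\in V$ and an integer $\ell\ge0$ let $\mathsf{SAW}(v,\ell)$ be the set of self-avoiding walks (simple paths) of length $\ell$ in $G$ starting at $v$, and $$\mathcal E_\delta(v,\ell)=\sum_{(v,v_1,\dots,v_\ell)\in\mathsf{SAW}(v,\ell)}\ \prod_{i=1}^{\ell}\delta(\deg_G v_i).$$ Call a vertex $u$ of $G$ low-degree if $\deg_G(u)<\frac{q-1}{1-\beta}-2$. A set $B\subseteq V$ is a permissive block if every vertex of $V\setminus B$ that has a neighbour in $B$ is low-degree; for $S\subseteq V$ let $B(S)$ be the minimal permissive block containing $S$, and for a path $P$ let $B(P)$ be the minimal permissive block containing the vertices of $P$. Let $\mathcal G(n,d/n)$ be the random graph on $n$ vertices in which each pair of vertices is joined independently with probability $d/n$. All asymptotics are for $n\to\infty$. **Theorem.** There is a constant $d_0$ such that for all real $d\ge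 d_0$, all $0\le\beta<1$ and all integers $q>3(1-\beta)d+4$ there are constants $C>0$, $0<\gamma<1$ and $C'>0$ (depending only on $d,\beta,q$) such that, for every function $L(n)=o(\sqrt n)$ with values in the non-negative integers, $G\sim\mathcal G(n,d/n)$ has the following three properties simultaneously with probability $1-o(1)$: 1. $\mathcal E_\delta(v,\ell)<n^C\gamma^\ell$ for all vertices $v$ and all $0\le\ell\le L(n)$; 2. if $\beta=0$, then $G$ is $q$-colorable; 3. for every $\ell\ge0$, every path $P$ of length $\ell$ in $G$ satisfies $|B(P)|\le C'(\ell+\log n)$. Moreover, the first and third properties hold with the following probabilities. * Let $d>1$, $0\le\beta<1$, and let $q>3(1-\beta)d+4$ be an integer. There are constants $C>0$ and $0<\gamma<1$ such that for every $L(n)=o(\sqrt n)$, with probability $1-O(1/n)$ over $G\sim\mathcal G(n,d/n)$, one has $\mathcal E_\delta(v,\ell)\le n^C\gamma^\ell$ for all vertices $v$ and all $0\le\ell\le L(n)$. * For every $\varepsilon>0$ there is $d_0$ such that for all real $d\ge d_0$, all integers $q\ge(2+\varepsilon)d$ and all $0\le\beta<1$ there is a constant $C>0$ such that, with probability $1-O(1/n)$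 over $G\sim\mathcal G(n,d/n)$, for every $\ell\ge 0$ every path $P$ of length $\ell$ in $G$ satisfies $|B(P)|\le C(\ell+\log n)$. -/

import Mathlib

open Filter Topology Asymptotics

namespace PottsGnp

/-- The contraction function of the `q`-state Potts model with activity `β`:
`δ(k) = 2(1-β) / (q-1-(1-β)k)` if `k ≤ (q-1)/(1-β) - 2`, and `δ(k) = 1` otherwise. -/
noncomputable def delta (q : ℕ) (β : ℝ) (k : ℕ) : ℝ :=
  if (k : ℝ) ≤ ((q : ℝ) - 1) / (1 - β) - 2 then
    2 * (1 - β) / ((q : ℝ) - 1 - (1 - β) * (k : ℝ))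
  else 1

/-- `P = (v₀, v₁, …, v_ℓ)` is a path (self-avoiding walk) of length `ℓ` in `G`:
consecutive vertices are adjacent and no vertex is repeated. -/
def IsPath {V : Type*} (G : SimpleGraph V) {ℓ : ℕ} (P : Fin (ℓ + 1) → V) : Prop :=
  Function.Injective P ∧ ∀ i : Fin ℓ, G.Adj (P i.castSucc) (P i.succ)

open Classical in
/-- The finite set `SAW(v, ℓ)` of self-avoiding walks of length `ℓ` starting at `v`. -/
noncomputable def SAW {V : Type*} [Fintype V] (G : SimpleGraph V) (v : V) (ℓ : ℕ) :
    Finset (Fin (ℓ + 1) → V) :=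
  Finset.univ.filter fun P => P 0 = v ∧ IsPath G P

open Classical in
/-- `𝓔_δ(v, ℓ)`: the sum over the self-avoiding walks `(v, v₁, …, v_ℓ)` of
`∏_{i=1}^ℓ δ(deg vᵢ)`. -/
noncomputable def sawSum {V : Type*} [Fintype V] (δ : ℕ → ℝ) (G : SimpleGraph V)
    (v : V) (ℓ : ℕ) : ℝ :=
  ∑ P ∈ SAW G v ℓ, ∏ i : Fin ℓ, δ (G.degree (P i.succ))

open Classical in
/-- A vertex is of low degree if its degree is `< (q-1)/(1-β) - 2`. -/
def IsLowDegree {V : Type*} [Fintype V] (q : ℕ) (β : ℝ) (G : SimpleGraph V) (v : V) : Prop :=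
  (G.degree v : ℝ) < ((q : ℝ) - 1) / (1 - β) - 2

/-- The vertex boundary `∂B`: the vertices outside `B` that have a neighbour in `B`. -/
def vertexBoundary {V : Type*} (G : SimpleGraph V) (B : Set V) : Set V :=
  {u | u ∉ B ∧ ∃ w ∈ B, G.Adj u w}

/-- `B` is a permissive block (no vertex being pinned): every vertex of its boundary is of
low degree. -/
def IsPermissive {V : Type*} [Fintype V] (q : ℕ) (β : ℝ) (G : SimpleGraph V) (B : Set V) : Prop :=
  ∀ u ∈ vertexBoundary G B, IsLowDegree q β G u

/-- `B(S)`: the minimal permissive block containing `S`. -/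
def permissiveBlock {V : Type*} [Fintype V] (q : ℕ) (β : ℝ) (G : SimpleGraph V) (S : Set V) :
    Set V :=
  ⋂₀ {B | S ⊆ B ∧ IsPermissive q β G B}

/-- `B(S)` is indeed the least permissive block containing `S`. -/
theorem permissiveBlock_isLeast {V : Type*} [Fintype V] (q : ℕ) (β : ℝ) (G : SimpleGraph V)
    (S : Set V) :
    IsLeast {B | S ⊆ B ∧ IsPermissive q β G B} (permissiveBlock q β G S) := by
  refine ⟨⟨Set.subset_sInter fun B hB => hB.1, ?_⟩, fun B hB => Set.sInter_subset_of_mem hB⟩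
  rintro u ⟨hu, w, hw, huw⟩
  simp only [permissiveBlock, Set.mem_sInter, not_forall] at hu
  obtain ⟨B, hB, huB⟩ := hu
  exact hB.2 u ⟨huB, w, Set.mem_sInter.1 hw B hB, huw⟩

/-- The law of the random graph `𝒢(n, d/n)` on the vertex set `Fin n`: every pair of distinct
vertices is an edge independently with probability `d/n` (truncated to `[0,1]`, which matters
only for the finitely many `n < d`). -/
noncomputable def gnp (n : ℕ) (d : ℝ) : MeasureTheory.Measure (SimpleGraph (Fin n)) :=
  SimpleGraph.binomialRandom (Fin n) (Set.projIcc (0 : ℝ) 1 zero_le_one (d / (n : ℝ)))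

/-- Every path `P` of length `ℓ` in `G` satisfies `|B(P)| ≤ C (ℓ + log |V|)`. -/
def LocallySparse {V : Type*} [Fintype V] (q : ℕ) (β C : ℝ) (G : SimpleGraph V) : Prop :=
  ∀ (ℓ : ℕ) (P : Fin (ℓ + 1) → V), IsPath G P →
    ((permissiveBlock q β G (Set.range P)).ncard : ℝ) ≤
      C * ((ℓ : ℝ) + Real.log (Fintype.card V : ℝ))

end PottsGnp

/-! All three properties are first moment bounds. `one_sub_gnp_real_le` bounds a failure probability
by the mean of a weight that is at least 1 on bad graphs. `gnp_real_eq` turns probabilities into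
finite sums `bernExp` over Bernoulli sets of pairs, where independence is `bernExp_union_mul` and
exponential moments come from `bernExp_prod_le`.

Walk sums: a vertex of a walk has degree at most 2, plus the number `X` of its edges leaving the
walk, plus its chords. The leaving pairs are disjoint for distinct vertices, so the `X` are
independent binomials of mean at most `d`. A chord costs a factor at most 3/2 per endpoint, in total
`exp (O(1))` when `ℓ = O(√n)`. At most `n ^ ℓ` walks start at a vertex, each present with
probability `(d/n) ^ ℓ`, so the mean decays geometrically as soon as `d · E δ(2 + X) < 1`.
Dominating `δ` by a quartic centred at `d` and inserting binomial central moments gives this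
(`binExp_delta_le`, `mul_meanBound_lt_one`).

Blocks: a large block yields a breadth-first exploration from the path in which every attached
vertex is not of low degree (`exists_exploration`), hence has degree at least `2 * d - 3`, nearly
twice the mean. A Chernoff bound makes this exponentially small in `d` per vertex, which beats the
factor `9 * d` for choosing and placing the exploration (`bernExp_explorationSum_le`,
`eventually_mul_attachFactor_le`).

Coloring: if greedy coloring fails, some set `S` has inner minimum degree at least `q`, hence at
least `3/2 * d * #S` edges, three times what is expected even for the whole vertex set. A Chernoff
bound and a union bound over `S` exclude this (`choose_mul_exp_le`). -/

namespace PottsGnp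

open Finset

/-! ### Expectations over Bernoulli random subsets -/

section BernoulliSubset

variable {α : Type*}

/-- The expectation of `F T`, where `T` is a random subset of `s` containing each element
independently with probability `p`. -/
noncomputable def bernExp (p : ℝ) (s : Finset α) (F : Finset α → ℝ) : ℝ :=
  ∑ T ∈ s.powerset, p ^ #T * (1 - p) ^ (#s - #T) * F T

theorem bernExp_empty (p : ℝ) (F : Finset α → ℝ) : bernExp p ∅ F = F ∅ := by
  simp [bernExp]

theorem bernExp_congr (p : ℝ) {s : Finset α} {F H : Finset α → ℝ} (h : ∀ T ⊆ s, F T = H T) :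
    bernExp p s F = bernExp p s H :=
  Finset.sum_congr rfl fun T hT => by rw [h T (Finset.mem_powerset.1 hT)]

theorem bernExp_mono {p : ℝ} (hp0 : 0 ≤ p) (hp1 : p ≤ 1) {s : Finset α} {F H : Finset α → ℝ}
    (h : ∀ T ⊆ s, F T ≤ H T) : bernExp p s F ≤ bernExp p s H :=
  Finset.sum_le_sum fun T hT => mul_le_mul_of_nonneg_left (h T (Finset.mem_powerset.1 hT))
    (mul_nonneg (pow_nonneg hp0 _) (pow_nonneg (sub_nonneg.2 hp1) _))

theorem bernExp_const_mul (p : ℝ) (s : Finset α) (c : ℝ) (F : Finset α → ℝ) :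
    bernExp p s (fun T => c * F T) = c * bernExp p s F := by
  unfold bernExp
  rw [Finset.mul_sum]
  exact Finset.sum_congr rfl fun T _ => by ring

theorem bernExp_mul_const (p : ℝ) (s : Finset α) (c : ℝ) (F : Finset α → ℝ) :
    bernExp p s (fun T => F T * c) = bernExp p s F * c := by
  simp_rw [mul_comm _ c, bernExp_const_mul]

theorem bernExp_sum {κ : Type*} (p : ℝ) (s : Finset α) (I : Finset κ)
    (F : κ → Finset α → ℝ) :
    bernExp p s (fun T => ∑ i ∈ I, F i T) = ∑ i ∈ I, bernExp p s (F i) := by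
  unfold bernExp
  simp_rw [Finset.mul_sum]
  exact Finset.sum_comm

theorem bernExp_add (p : ℝ) (s : Finset α) (F H : Finset α → ℝ) :
    bernExp p s (fun T => F T + H T) = bernExp p s F + bernExp p s H := by
  unfold bernExp
  rw [← Finset.sum_add_distrib]
  exact Finset.sum_congr rfl fun T _ => by ring

theorem bernExp_nonneg {p : ℝ} (hp0 : 0 ≤ p) (hp1 : p ≤ 1) {s : Finset α} {F : Finset α → ℝ}
    (h : ∀ T ⊆ s, 0 ≤ F T) : 0 ≤ bernExp p s F :=
  Finset.sum_nonneg fun T hT =>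
    mul_nonneg (mul_nonneg (pow_nonneg hp0 _) (pow_nonneg (sub_nonneg.2 hp1) _))
      (h T (Finset.mem_powerset.1 hT))

variable [DecidableEq α]

theorem bernExp_insert (p : ℝ) {a : α} {s : Finset α} (ha : a ∉ s) (F : Finset α → ℝ) :
    bernExp p (insert a s) F =
      p * bernExp p s (fun T => F (insert a T)) + (1 - p) * bernExp p s F := by
  unfold bernExp
  rw [Finset.sum_powerset_insert ha, add_comm, Finset.mul_sum, Finset.mul_sum]
  congr 1
  · refine Finset.sum_congr rfl fun T hT => ?_
    have hT' := Finset.mem_powerset.1 hT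
    rw [Finset.card_insert_of_notMem fun h => ha (hT' h), Finset.card_insert_of_notMem ha,
      Nat.add_sub_add_right]
    ring
  · refine Finset.sum_congr rfl fun T hT => ?_
    have hT' := Finset.card_le_card (Finset.mem_powerset.1 hT)
    rw [Finset.card_insert_of_notMem ha, Nat.sub_add_comm hT']
    ring

theorem bernExp_union (p : ℝ) {s t : Finset α} (hst : Disjoint s t) (F : Finset α → ℝ) :
    bernExp p (s ∪ t) F = bernExp p s fun S => bernExp p t fun T => F (S ∪ T) := by
  induction s using Finset.induction_on generalizing F with
  | empty => simp [bernExp_empty]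
  | insert a s ha ih =>
    rw [Finset.disjoint_insert_left] at hst
    rw [Finset.insert_union, bernExp_insert p (by simp [ha, hst.1]), bernExp_insert p ha,
      ih hst.2, ih hst.2]
    simp_rw [Finset.insert_union]

/-- Functions of disjoint parts of a Bernoulli random set are independent. -/
theorem bernExp_union_mul (p : ℝ) {s t : Finset α} (hst : Disjoint s t) (F H : Finset α → ℝ) :
    bernExp p (s ∪ t) (fun T => F (T ∩ s) * H (T ∩ t)) = bernExp p s F * bernExp p t H := by
  rw [bernExp_union p hst, ← bernExp_mul_const]
  refine bernExp_congr p fun S hS => ?_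
  rw [← bernExp_const_mul]
  refine bernExp_congr p fun T hT => ?_
  have h1 : (S ∪ T) ∩ s = S := by
    rw [Finset.union_inter_distrib_right, Finset.inter_eq_left.2 hS,
      Finset.disjoint_iff_inter_eq_empty.1 (hst.symm.mono_left hT), Finset.union_empty]
  have h2 : (S ∪ T) ∩ t = T := by
    rw [Finset.union_inter_distrib_right, Finset.inter_eq_left.2 hT,
      Finset.disjoint_iff_inter_eq_empty.1 (hst.mono_left hS), Finset.empty_union]
  rw [h1, h2]

/-- The expectation of a product of weights over a Bernoulli random set that is required to
contain `K`. -/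
theorem bernExp_prod (p : ℝ) {s K : Finset α} (hK : K ⊆ s) (x : α → ℝ) :
    bernExp p s (fun T => if K ⊆ T then ∏ e ∈ T, x e else 0) =
      p ^ #K * (∏ e ∈ K, x e) * ∏ e ∈ s \ K, (1 + p * (x e - 1)) := by
  -- Requiring only `K ∩ s` lets the induction add one element at a time: the expectation
  -- factorizes, with a forced factor on `K` and a free one off `K`.
  have key : ∀ s : Finset α, bernExp p s (fun T => if K ∩ s ⊆ T then ∏ e ∈ T, x e else 0) =
      ∏ e ∈ s, (if e ∈ K then p * x e else 1 + p * (x e - 1)) := by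
    intro s
    induction s using Finset.induction_on with
    | empty => simp [bernExp_empty]
    | insert a s ha ih =>
      rw [Finset.prod_insert ha, bernExp_insert p ha, ← ih]
      have h1 : bernExp p s (fun T => if K ∩ insert a s ⊆ insert a T
            then ∏ e ∈ insert a T, x e else 0) =
          x a * bernExp p s (fun T => if K ∩ s ⊆ T then ∏ e ∈ T, x e else 0) := by
        rw [← bernExp_const_mul]
        refine bernExp_congr p fun T hT => ?_
        have haT : a ∉ T := fun h => ha (hT h)
        have : K ∩ insert a s ⊆ insert a T ↔ K ∩ s ⊆ T := by
          constructor
          · intro h e he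
            have he' := Finset.mem_inter.1 he
            have := h (Finset.mem_inter.2 ⟨he'.1, Finset.mem_insert_of_mem he'.2⟩)
            rcases Finset.mem_insert.1 this with rfl | h'
            · exact absurd he'.2 ha
            · exact h'
          · intro h e he
            have he' := Finset.mem_inter.1 he
            rcases Finset.mem_insert.1 he'.2 with rfl | h'
            · exact Finset.mem_insert_self _ _
            · exact Finset.mem_insert_of_mem (h (Finset.mem_inter.2 ⟨he'.1, h'⟩))
        simp only [this, Finset.prod_insert haT, mul_ite, mul_zero]
      by_cases haK : a ∈ K
      · have h2 : bernExp p s (fun T => if K ∩ insert a s ⊆ T then ∏ e ∈ T, x e else 0) = 0 := by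
          have : bernExp p s (fun T => if K ∩ insert a s ⊆ T then ∏ e ∈ T, x e else 0) =
              bernExp p s (fun T => 0 * 0) := by
            refine bernExp_congr p fun T hT => ?_
            rw [if_neg, mul_zero]
            intro h
            exact ha (hT (h (Finset.mem_inter.2 ⟨haK, Finset.mem_insert_self _ _⟩)))
          rw [this, bernExp_const_mul, zero_mul]
        rw [h1, h2, if_pos haK]
        ring
      · rw [h1, if_neg haK, Finset.inter_insert_of_notMem haK]
        ring
  have h := key s
  rw [Finset.inter_eq_left.2 hK] at h
  rw [h, ← Finset.prod_sdiff hK, mul_comm]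
  congr 1
  · rw [← Finset.prod_const, ← Finset.prod_mul_distrib]
    exact Finset.prod_congr rfl fun e he => by rw [if_pos he]
  · exact Finset.prod_congr rfl fun e he => by rw [if_neg (Finset.mem_sdiff.1 he).2]

/-- From `1 + y ≤ exp y`, with the exponent extended from `s \ K` to `s`. This is the Chernoff-type
estimate behind the chord, exploration and density bounds. -/
theorem bernExp_prod_le {p : ℝ} (hp0 : 0 ≤ p) {s K : Finset α} (hK : K ⊆ s)
    {x : α → ℝ} (hx : ∀ e, 1 ≤ x e) :
    bernExp p s (fun T => if K ⊆ T then ∏ e ∈ T, x e else 0) ≤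
      p ^ #K * (∏ e ∈ K, x e) * Real.exp (p * ∑ e ∈ s, (x e - 1)) := by
  rw [bernExp_prod p hK]
  refine mul_le_mul_of_nonneg_left ?_
    (mul_nonneg (pow_nonneg hp0 _) (Finset.prod_nonneg fun e _ => zero_le_one.trans (hx e)))
  have h1 : ∏ e ∈ s \ K, (1 + p * (x e - 1)) ≤ ∏ e ∈ s \ K, Real.exp (p * (x e - 1)) := by
    refine Finset.prod_le_prod (fun e _ => ?_) fun e _ => ?_
    · have := mul_nonneg hp0 (sub_nonneg.2 (hx e))
      linarith
    · rw [add_comm]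
      exact Real.add_one_le_exp _
  refine h1.trans ?_
  rw [← Real.exp_sum, ← Finset.mul_sum]
  refine Real.exp_le_exp.2 (mul_le_mul_of_nonneg_left ?_ hp0)
  exact Finset.sum_le_sum_of_subset_of_nonneg Finset.sdiff_subset
    fun e _ _ => sub_nonneg.2 (hx e)

/-- The expectation of `f X` for a binomial random variable `X` with parameters `N` and `p`. -/
noncomputable def binExp (p : ℝ) : ℕ → (ℕ → ℝ) → ℝ
  | 0, f => f 0
  | N + 1, f => p * binExp p N (fun k => f (k + 1)) + (1 - p) * binExp p N f

theorem binExp_one (p : ℝ) (N : ℕ) : binExp p N (fun _ => 1) = 1 := by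
  induction N with
  | zero => rfl
  | succ N ih => rw [binExp, ih]; ring

theorem bernExp_card (p : ℝ) (s : Finset α) (f : ℕ → ℝ) :
    bernExp p s (fun T => f #T) = binExp p #s f := by
  induction s using Finset.induction_on generalizing f with
  | empty => simp [bernExp_empty, binExp]
  | insert a s ha ih =>
    rw [bernExp_insert p ha, Finset.card_insert_of_notMem ha, binExp, ih, ← ih fun k => f (k + 1)]
    congr 2
    exact bernExp_congr p fun T hT => by rw [Finset.card_insert_of_notMem fun h => ha (hT h)]

theorem bernExp_const (p : ℝ) (s : Finset α) (c : ℝ) : bernExp p s (fun _ => c) = c := by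
  have h := bernExp_const_mul p s c fun _ => 1
  rw [bernExp_card p s fun _ => 1, binExp_one] at h
  simpa using h

/-- Counts in disjoint cells are independent binomials; cells are split off one at a time. -/
theorem bernExp_prod_card {κ : Type*} [DecidableEq κ] (p : ℝ) (f : ℕ → ℝ) (A : κ → Finset α)
    (I : Finset κ) {s : Finset α} (hs : ∀ i ∈ I, A i ⊆ s)
    (hd : ∀ i ∈ I, ∀ j ∈ I, i ≠ j → Disjoint (A i) (A j)) :
    bernExp p s (fun T => ∏ i ∈ I, f #(T ∩ A i)) = ∏ i ∈ I, binExp p #(A i) f := by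
  induction I using Finset.induction_on generalizing s with
  | empty => simpa using bernExp_const p s 1
  | insert a I ha ih =>
    have has := hs a (Finset.mem_insert_self _ _)
    have hdis : ∀ i ∈ I, Disjoint (A a) (A i) := fun i hi =>
      hd a (Finset.mem_insert_self _ _) i (Finset.mem_insert_of_mem hi) fun h => ha (h ▸ hi)
    have hsub : ∀ i ∈ I, A i ⊆ s \ A a := fun i hi =>
      Finset.subset_sdiff.2 ⟨hs i (Finset.mem_insert_of_mem hi), (hdis i hi).symm⟩
    have h := ih hsub fun i hi j hj =>
      hd i (Finset.mem_insert_of_mem hi) j (Finset.mem_insert_of_mem hj)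
    rw [Finset.prod_insert ha, ← h, ← bernExp_card, ← bernExp_union_mul p Finset.disjoint_sdiff,
      Finset.union_sdiff_of_subset has]
    refine bernExp_congr p fun T _ => ?_
    rw [Finset.prod_insert ha]
    congr 1
    refine Finset.prod_congr rfl fun i hi => ?_
    rw [Finset.inter_assoc, Finset.inter_eq_right.2 (hsub i hi)]

end BernoulliSubset

/-! ### Monotonicity and moments of the binomial distribution -/

theorem binExp_mono {p : ℝ} (hp0 : 0 ≤ p) (hp1 : p ≤ 1) (N : ℕ) {f g : ℕ → ℝ}
    (h : ∀ k, f k ≤ g k) : binExp p N f ≤ binExp p N g := by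
  induction N generalizing f g with
  | zero => exact h 0
  | succ N ih =>
    exact add_le_add (mul_le_mul_of_nonneg_left (ih fun k => h (k + 1)) hp0)
      (mul_le_mul_of_nonneg_left (ih h) (sub_nonneg.2 hp1))

theorem binExp_le_of_le {p : ℝ} (hp0 : 0 ≤ p) (hp1 : p ≤ 1) {f : ℕ → ℝ} (hf : Monotone f)
    {M N : ℕ} (hMN : M ≤ N) : binExp p M f ≤ binExp p N f := by
  induction N, hMN using Nat.le_induction with
  | base => exact le_rfl
  | succ N _ ih =>
    have := binExp_mono hp0 hp1 N fun k => hf (Nat.le_succ k)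
    have h := mul_le_mul_of_nonneg_left this hp0
    change _ ≤ p * binExp p N (fun k => f (k + 1)) + (1 - p) * binExp p N f
    linarith

theorem binExp_add (p : ℝ) (N : ℕ) (f g : ℕ → ℝ) :
    binExp p N (fun k => f k + g k) = binExp p N f + binExp p N g := by
  induction N generalizing f g with
  | zero => rfl
  | succ N ih => simp only [binExp, ih]; ring

theorem binExp_const_mul (p : ℝ) (N : ℕ) (c : ℝ) (f : ℕ → ℝ) :
    binExp p N (fun k => c * f k) = c * binExp p N f := by
  induction N generalizing f with
  | zero => rfl
  | succ N ih => simp only [binExp, ih]; ring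

/-- In this and the next three moments the centre `c` is arbitrary because a successful trial shifts
it to `c - 1` in the induction. -/
theorem binExp_sub (p : ℝ) (N : ℕ) (c : ℝ) :
    binExp p N (fun k => (k : ℝ) - c) = N * p - c := by
  induction N generalizing c with
  | zero => simp [binExp]
  | succ N ih =>
    have h := ih (c - 1)
    simp only [binExp]
    push_cast
    rw [ih, show (fun k : ℕ => (k : ℝ) + 1 - c) = fun k : ℕ => (k : ℝ) - (c - 1) by ext; ring, h]
    ring

theorem binExp_sub_sq (p : ℝ) (N : ℕ) (c : ℝ) :
    binExp p N (fun k => ((k : ℝ) - c) ^ 2) = (N * p - c) ^ 2 + N * p * (1 - p) := by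
  induction N generalizing c with
  | zero => simp [binExp]
  | succ N ih =>
    have h := ih (c - 1)
    simp only [binExp]
    push_cast
    rw [ih, show (fun k : ℕ => ((k : ℝ) + 1 - c) ^ 2) = fun k : ℕ => ((k : ℝ) - (c - 1)) ^ 2 by
      ext; ring, h]
    ring

theorem binExp_sub_cube (p : ℝ) (N : ℕ) (c : ℝ) :
    binExp p N (fun k => ((k : ℝ) - c) ^ 3) =
      (N * p - c) ^ 3 + 3 * (N * p - c) * (N * p * (1 - p)) + N * p * (1 - p) * (1 - 2 * p) := by
  induction N generalizing c with
  | zero => simp [binExp]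
  | succ N ih =>
    have h := ih (c - 1)
    simp only [binExp]
    push_cast
    rw [ih, show (fun k : ℕ => ((k : ℝ) + 1 - c) ^ 3) = fun k : ℕ => ((k : ℝ) - (c - 1)) ^ 3 by
      ext; ring, h]
    ring

theorem binExp_sub_four (p : ℝ) (N : ℕ) (c : ℝ) :
    binExp p N (fun k => ((k : ℝ) - c) ^ 4) =
      (N * p - c) ^ 4 + 6 * (N * p - c) ^ 2 * (N * p * (1 - p)) +
        4 * (N * p - c) * (N * p * (1 - p) * (1 - 2 * p)) + 3 * (N * p * (1 - p)) ^ 2 +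
        N * p * (1 - p) * (1 - 6 * p * (1 - p)) := by
  induction N generalizing c with
  | zero => simp [binExp]
  | succ N ih =>
    have h := ih (c - 1)
    simp only [binExp]
    push_cast
    rw [ih, show (fun k : ℕ => ((k : ℝ) + 1 - c) ^ 4) = fun k : ℕ => ((k : ℝ) - (c - 1)) ^ 4 by
      ext; ring, h]
    ring

/-! ### The random graph as a Bernoulli set of pairs -/

section RandomGraph

variable {V : Type*} [DecidableEq V]

/-- Double counting of the incidences between `s` and the pairs in `T`. -/
theorem sum_card_incident (s : Finset V) (T : Finset (Sym2 V)) :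
    ∑ v ∈ s, #{e ∈ T | v ∈ e} = ∑ e ∈ T, #{v ∈ s | v ∈ e} :=
  Finset.sum_card_bipartiteAbove_eq_sum_card_bipartiteBelow fun (v : V) (e : Sym2 V) => v ∈ e

theorem card_incident_le_two (s : Finset V) (e : Sym2 V) : #{v ∈ s | v ∈ e} ≤ 2 := by
  induction e with
  | _ a b =>
    refine (Finset.card_le_card fun v hv => ?_).trans (Finset.card_le_two (a := a) (b := b))
    simpa using (Finset.mem_filter.1 hv).2

variable [Fintype V]

variable (V) in
/-- The unordered pairs of distinct vertices. -/
def vertexPairs : Finset (Sym2 V) :=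
  Finset.univ.filter fun e => ¬ e.IsDiag

theorem mem_vertexPairs {e : Sym2 V} : e ∈ vertexPairs V ↔ ¬ e.IsDiag := by
  simp [vertexPairs]

theorem mk_mem_vertexPairs {u v : V} : s(u, v) ∈ vertexPairs V ↔ u ≠ v := by
  simp [vertexPairs]

theorem card_vertexPairs : #(vertexPairs V) = (Fintype.card V).choose 2 := by
  rw [← Sym2.card_diagSet_compl, Fintype.card_subtype]
  congr 1

theorem edgeSet_fromEdgeSet_of_subset {T : Finset (Sym2 V)} (hT : T ⊆ vertexPairs V) :
    (SimpleGraph.fromEdgeSet (T : Set (Sym2 V))).edgeSet = T := by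
  rw [SimpleGraph.edgeSet_fromEdgeSet]
  ext e
  simp only [Set.mem_sdiff, Finset.mem_coe, Sym2.mem_diagSet, and_iff_left_iff_imp]
  exact fun he => mem_vertexPairs.1 (hT he)

theorem degree_fromEdgeSet {T : Finset (Sym2 V)} (hT : T ⊆ vertexPairs V) (v : V)
    [Fintype ((SimpleGraph.fromEdgeSet (T : Set (Sym2 V))).neighborSet v)] :
    (SimpleGraph.fromEdgeSet (T : Set (Sym2 V))).degree v = #{e ∈ T | v ∈ e} := by
  rw [← SimpleGraph.card_incidenceFinset_eq_degree]
  congr 1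
  ext e
  rw [SimpleGraph.mem_incidenceFinset, SimpleGraph.incidenceSet, edgeSet_fromEdgeSet_of_subset hT]
  simp

theorem adj_fromEdgeSet {T : Finset (Sym2 V)} (hT : T ⊆ vertexPairs V) {u v : V} :
    (SimpleGraph.fromEdgeSet (T : Set (Sym2 V))).Adj u v ↔ s(u, v) ∈ T := by
  rw [SimpleGraph.fromEdgeSet_adj]
  exact ⟨fun h => h.1, fun h => ⟨h, mk_mem_vertexPairs.1 (hT h)⟩⟩

instance : MeasurableSingletonClass (SimpleGraph V) where
  measurableSet_singleton G := by
    have : ({G} : Set (SimpleGraph V)) = SimpleGraph.edgeSet ⁻¹' {G.edgeSet} := by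
      ext H
      simp
    rw [this]
    exact SimpleGraph.measurableEmbedding_edgeSet.measurable (measurableSet_singleton _)

open Classical in
theorem gnp_real_eq {n : ℕ} {d : ℝ} (hn : 0 < n) (hd0 : 0 ≤ d) (hdn : d ≤ n)
    (Q : SimpleGraph (Fin n) → Prop) :
    (gnp n d).real {G | Q G} = bernExp (d / n) (vertexPairs (Fin n))
      fun T => if Q (SimpleGraph.fromEdgeSet T) then 1 else 0 := by
  have hn' : (0 : ℝ) < n := Nat.cast_pos.2 hn
  have hp : d / n ∈ Set.Icc (0 : ℝ) 1 := ⟨by positivity, (div_le_one hn').2 hdn⟩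
  have hs : ∀ T ⊆ vertexPairs (Fin n), (gnp n d).real {SimpleGraph.fromEdgeSet (T : Set _)} =
      (d / n) ^ #T * (1 - d / n) ^ (#(vertexPairs (Fin n)) - #T) := by
    intro T hT
    rw [gnp, MeasureTheory.measureReal_def, SimpleGraph.binomialRandom_singleton,
      edgeSet_fromEdgeSet_of_subset hT, Set.projIcc_of_mem _ hp, Set.ncard_coe_finset,
      card_vertexPairs, Nat.card_eq_fintype_card]
    simp
  rw [← Set.coe_toFinset {G | Q G}, gnp, ← MeasureTheory.sum_measureReal_singleton, bernExp]
  simp_rw [mul_ite, mul_one, mul_zero]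
  rw [← Finset.sum_filter]
  symm
  refine Finset.sum_bij' (fun T _ => SimpleGraph.fromEdgeSet (T : Set _))
    (fun G _ => G.edgeSet.toFinset) ?_ ?_ ?_ ?_ ?_
  · intro T hT
    simpa using (Finset.mem_filter.1 hT).2
  · intro G hG
    simp only [Set.mem_toFinset, Set.mem_ofPred_eq] at hG
    simp only [Finset.mem_filter, Finset.mem_powerset, Set.coe_toFinset,
      SimpleGraph.fromEdgeSet_edgeSet]
    refine ⟨fun e he => mem_vertexPairs.2 ?_, hG⟩
    exact G.not_isDiag_of_mem_edgeSet (by simpa using he)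
  · intro T hT
    have hT' := Finset.mem_powerset.1 (Finset.mem_filter.1 hT).1
    ext e
    refine (@Set.mem_toFinset _ _ (_) _).trans ?_
    rw [edgeSet_fromEdgeSet_of_subset hT', Finset.mem_coe]
  · intro G _
    simp
  · intro T hT
    exact (hs T (Finset.mem_powerset.1 (Finset.mem_filter.1 hT).1)).symm

theorem card_vertexPairs_filter_mem_le (v : V) :
    #{e ∈ vertexPairs V | v ∈ e} ≤ Fintype.card V := by
  refine (Finset.card_le_card (t := Finset.univ.image fun w => s(v, w)) fun e he => ?_).trans
    Finset.card_image_le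
  obtain ⟨w, rfl⟩ := (Finset.mem_filter.1 he).2
  simp

/-- First moment method: if a nonnegative weight is at least `1` wherever `Q` fails, then `Q` fails
with probability at most the mean of the weight. -/
theorem one_sub_gnp_real_le {n : ℕ} {d : ℝ} (hn : 0 < n) (hd0 : 0 ≤ d) (hdn : d ≤ n)
    {Q : SimpleGraph (Fin n) → Prop} {W : Finset (Sym2 (Fin n)) → ℝ}
    (hW0 : ∀ T ⊆ vertexPairs (Fin n), 0 ≤ W T)
    (hW : ∀ T ⊆ vertexPairs (Fin n), ¬ Q (SimpleGraph.fromEdgeSet T) → 1 ≤ W T) :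
    1 - (gnp n d).real {G | Q G} ≤ bernExp (d / n) (vertexPairs (Fin n)) W := by
  classical
  have hn' : (0 : ℝ) < n := Nat.cast_pos.2 hn
  rw [gnp_real_eq hn hd0 hdn, sub_le_iff_le_add', ← bernExp_add]
  refine (bernExp_const (d / n) (vertexPairs (Fin n)) 1).symm.trans_le ?_
  refine bernExp_mono (by positivity) ((div_le_one hn').2 hdn) fun T hT => ?_
  by_cases h : Q (SimpleGraph.fromEdgeSet T)
  · have := hW0 T hT
    simp only [h, if_true]
    linarith
  · have := hW T hT h
    simp only [h, if_false]
    linarith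

instance (n : ℕ) (d : ℝ) : MeasureTheory.IsProbabilityMeasure (gnp n d) := by
  unfold gnp
  infer_instance

/-- The pairs of distinct vertices in `S`. -/
def innerPairs (S : Finset V) : Finset (Sym2 V) :=
  vertexPairs V ∩ S.sym2

theorem mem_innerPairs {S : Finset V} {e : Sym2 V} :
    e ∈ innerPairs S ↔ e ∈ vertexPairs V ∧ ∀ v ∈ e, v ∈ S := by
  rw [innerPairs, Finset.mem_inter, Finset.mem_sym2_iff]

theorem innerPairs_subset (S : Finset V) : innerPairs S ⊆ vertexPairs V :=
  Finset.inter_subset_left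

theorem two_mul_card_innerPairs_le (S : Finset V) : 2 * #(innerPairs S) ≤ #S ^ 2 := by
  have h : innerPairs S ⊆ S.offDiag.image (Function.uncurry Sym2.mk) := by
    intro e he
    induction e with
    | _ a b =>
      rw [mem_innerPairs, mk_mem_vertexPairs] at he
      exact Finset.mem_image.2 ⟨(a, b), Finset.mem_offDiag.2
        ⟨he.2 a (Sym2.mem_mk_left a b), he.2 b (Sym2.mem_mk_right a b), he.1⟩, rfl⟩
  have h2 := Finset.card_le_card h
  have h3 := Sym2.two_mul_card_image_offDiag S
  rw [Finset.offDiag_card] at h3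
  rw [sq]
  omega

end RandomGraph

/-! ### The mean of the contraction function under a binomial degree -/

section ContractionFunction

variable {q : ℕ} {β : ℝ}

/-- Cancelling `1 - β` shows that `q` and `β` enter only through `(q - 1) / (1 - β)`. -/
theorem delta_eq (hβ : β < 1) (k : ℕ) :
    delta q β k = if (k : ℝ) ≤ ((q : ℝ) - 1) / (1 - β) - 2 then
      2 / (((q : ℝ) - 1) / (1 - β) - k) else 1 := by
  have hc : 0 < 1 - β := sub_pos.2 hβ
  unfold delta
  split_ifs with h
  · have h1 : 0 < ((q : ℝ) - 1) / (1 - β) - k := by linarith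
    have h2 : (q : ℝ) - 1 - (1 - β) * k = (1 - β) * (((q : ℝ) - 1) / (1 - β) - k) := by
      field_simp
    rw [h2]
    field_simp
  · rfl

theorem delta_pos (hβ : β < 1) (k : ℕ) : 0 < delta q β k := by
  rw [delta_eq hβ]
  split_ifs with h
  · exact div_pos two_pos (by linarith)
  · exact one_pos

theorem delta_le_one (hβ : β < 1) (k : ℕ) : delta q β k ≤ 1 := by
  rw [delta_eq hβ]
  split_ifs with h
  · exact (div_le_one (by linarith)).2 (by linarith)
  · exact le_rfl

theorem delta_monotone (hβ : β < 1) : Monotone (delta q β) := by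
  refine monotone_nat_of_le_succ fun k => ?_
  by_cases h : ((k + 1 : ℕ) : ℝ) ≤ ((q : ℝ) - 1) / (1 - β) - 2
  · rw [delta_eq hβ, delta_eq hβ, if_pos h]
    push_cast at h ⊢
    rw [if_pos (by linarith)]
    exact div_le_div_of_nonneg_left two_pos.le (by linarith) (by linarith)
  · rw [delta_eq hβ (k + 1), if_neg h]
    exact delta_le_one hβ k

/-- With `b = (q - 1) / (1 - β)`, the ratio `(b - k) / (b - k - 1)` is largest at the threshold `b -
k = 3`. This prices one extra edge, such as a chord. -/
theorem delta_succ_le (hβ : β < 1) (k : ℕ) : delta q β (k + 1) ≤ 3 / 2 * delta q β k := by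
  by_cases h : ((k + 1 : ℕ) : ℝ) ≤ ((q : ℝ) - 1) / (1 - β) - 2
  · rw [delta_eq hβ, delta_eq hβ, if_pos h]
    push_cast at h ⊢
    rw [if_pos (by linarith), ← mul_div_assoc, div_le_div_iff₀ (by linarith) (by linarith)]
    linarith
  · rw [delta_eq hβ (k + 1), if_neg h, delta_eq hβ]
    push_cast at h
    split_ifs with h'
    · rw [← mul_div_assoc, le_div_iff₀ (by linarith)]
      linarith
    · norm_num

theorem delta_add_le (hβ : β < 1) (k j : ℕ) :
    delta q β (k + j) ≤ (3 / 2) ^ j * delta q β k := by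
  induction j with
  | zero => simp
  | succ j ih =>
    rw [← add_assoc, pow_succ']
    have := delta_succ_le (q := q) hβ (k + j)
    nlinarith

/-- Geometric expansion to third order; the exact remainder is `2 / (b - y) * (y / b) ^ 4`, and its
first factor is at most 1. -/
theorem two_div_sub_le_quartic {b y : ℝ} (hb : 0 < b) (hy : 2 ≤ b - y) :
    2 / (b - y) ≤ 2 / b * (1 + y / b + (y / b) ^ 2 + (y / b) ^ 3) + (y / b) ^ 4 := by
  have hby : 0 < b - y := by linarith
  have h : 2 / (b - y) = 2 / b * (1 + y / b + (y / b) ^ 2 + (y / b) ^ 3) +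
      2 / (b - y) * (y / b) ^ 4 := by
    field_simp
    ring
  have h2 : 2 / (b - y) ≤ 1 := (div_le_one hby).2 hy
  have h3 : 0 ≤ (y / b) ^ 4 := by positivity
  rw [h]
  nlinarith

/-- The quartic increases for `y ≥ 0` and already dominates 1 at `y = b - 2`, so it also covers
degrees where `δ` is capped. -/
theorem one_le_quartic {b y : ℝ} (hb : 2 ≤ b) (hy : b - y ≤ 2) :
    1 ≤ 2 / b * (1 + y / b + (y / b) ^ 2 + (y / b) ^ 3) + (y / b) ^ 4 := by
  have h := two_div_sub_le_quartic (b := b) (y := b - 2) (by linarith) (by linarith)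
  have hb0 : 0 < b := by linarith
  have h1 : 0 ≤ (b - 2) / b := div_nonneg (by linarith) hb0.le
  have h2 : (b - 2) / b ≤ y / b := div_le_div_of_nonneg_right (by linarith) hb0.le
  rw [show 2 / (b - (b - 2)) = 1 by rw [sub_sub_cancel]; norm_num] at h
  refine h.trans ?_
  gcongr

/-- Take `b = 2 * d + 1` and `y = k - d`, so that `b - y = (3 * d + 3) - (2 + k)`. Centring at the
mean `d` makes the linear term vanish in expectation. -/
theorem delta_two_add_le_quartic (hβ : β < 1) {d : ℝ} (hd : 1 / 2 ≤ d)
    (hq : 3 * d + 3 ≤ ((q : ℝ) - 1) / (1 - β)) (k : ℕ) :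
    delta q β (2 + k) ≤ 2 / (2 * d + 1) * (1 + (k - d) / (2 * d + 1) +
      ((k - d) / (2 * d + 1)) ^ 2 + ((k - d) / (2 * d + 1)) ^ 3) +
      ((k - d) / (2 * d + 1)) ^ 4 := by
  by_cases h : 2 ≤ (2 * d + 1) - (k - d)
  · refine le_trans ?_ (two_div_sub_le_quartic (by linarith) h)
    rw [delta_eq hβ]
    push_cast
    rw [if_pos (by linarith)]
    exact div_le_div_of_nonneg_left two_pos.le (by linarith) (by linarith)
  · exact (delta_le_one hβ _).trans (one_le_quartic (by linarith) (not_le.1 h).le)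

/-- An upper bound for the mean of `δ(2 + X)` for `X` binomial of mean `d`. -/
noncomputable def meanBound (d : ℝ) : ℝ :=
  2 / (2 * d + 1) * (1 + d / (2 * d + 1) ^ 2 + d / (2 * d + 1) ^ 3) +
    (3 * d ^ 2 + d) / (2 * d + 1) ^ 4

theorem meanBound_pos {d : ℝ} (hd : 0 < d) : 0 < meanBound d := by
  unfold meanBound
  positivity

theorem mul_meanBound_lt_one {d : ℝ} (hd : 0 < d) : d * meanBound d < 1 := by
  have hb : 0 < 2 * d + 1 := by linarith
  have h : d * meanBound d = (2 * d * ((2 * d + 1) ^ 3 + d * (2 * d + 1) + d) +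
      d * (3 * d ^ 2 + d)) / (2 * d + 1) ^ 4 := by
    unfold meanBound
    field_simp
  rw [h, div_lt_one (by positivity)]
  -- The numerator is `16d⁴ + 31d³ + 17d² + 2d`, the denominator `16d⁴ + 32d³ + 24d² + 8d + 1`: the
  -- leading terms agree and the cubic term decides.
  have h2 : 0 < d ^ 2 := by positivity
  have h3 : 0 < d ^ 3 := by positivity
  nlinarith

theorem binExp_quartic_le {d : ℝ} {n : ℕ} (hd : 0 ≤ d) (hn : 0 < n) (hdn : d ≤ n) :
    binExp (d / n) n (fun k => 2 / (2 * d + 1) * (1 + (k - d) / (2 * d + 1) +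
      ((k - d) / (2 * d + 1)) ^ 2 + ((k - d) / (2 * d + 1)) ^ 3) +
      ((k - d) / (2 * d + 1)) ^ 4) ≤ meanBound d := by
  have hn' : (0 : ℝ) < n := Nat.cast_pos.2 hn
  set p := d / n with hp
  have hp0 : 0 ≤ p := by positivity
  have hp1 : p ≤ 1 := (div_le_one hn').2 hdn
  have hnp : n * p = d := by rw [hp]; field_simp
  set b := 2 * d + 1 with hb
  have hb0 : 0 < b := by linarith
  have hrw : (fun k : ℕ => 2 / b * (1 + ((k : ℝ) - d) / b +
      (((k : ℝ) - d) / b) ^ 2 + (((k : ℝ) - d) / b) ^ 3) + (((k : ℝ) - d) / b) ^ 4) =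
      fun k : ℕ => 2 / b * (1 + (1 / b * ((k : ℝ) - d) + (1 / b ^ 2 * ((k : ℝ) - d) ^ 2 +
        1 / b ^ 3 * ((k : ℝ) - d) ^ 3))) + 1 / b ^ 4 * ((k : ℝ) - d) ^ 4 := by
    ext k
    field_simp
    ring
  rw [hrw, binExp_add, binExp_const_mul, binExp_add, binExp_one, binExp_add, binExp_const_mul,
    binExp_add, binExp_const_mul, binExp_const_mul, binExp_const_mul, binExp_sub,
    binExp_sub_sq, binExp_sub_cube, binExp_sub_four, hnp, sub_self]
  have e2 : d * (1 - p) ≤ d := by nlinarith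
  have e2' : 0 ≤ d * (1 - p) := mul_nonneg hd (by linarith)
  have e3 : d * (1 - p) * (1 - 2 * p) ≤ d := by nlinarith
  have e4 : d * (1 - p) * (1 - 6 * p * (1 - p)) ≤ d := by
    have : 0 ≤ p * (1 - p) := mul_nonneg hp0 (by linarith)
    nlinarith
  have e5 : (d * (1 - p)) ^ 2 ≤ d ^ 2 := pow_le_pow_left₀ e2' e2 2
  unfold meanBound
  rw [← hb, div_eq_mul_one_div d (b ^ 2), div_eq_mul_one_div d (b ^ 3),
    div_eq_mul_one_div (3 * d ^ 2 + d) (b ^ 4), mul_comm d (1 / b ^ 2), mul_comm d (1 / b ^ 3),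
    mul_comm (3 * d ^ 2 + d), add_assoc 1]
  simp only [mul_zero, zero_mul, add_zero, zero_add, ne_eq, OfNat.ofNat_ne_zero,
    not_false_eq_true, zero_pow]
  have hb2 : 0 ≤ 2 / b := by positivity
  have hi2 : 0 ≤ 1 / b ^ 2 := by positivity
  have hi3 : 0 ≤ 1 / b ^ 3 := by positivity
  have hi4 : 0 ≤ 1 / b ^ 4 := by positivity
  refine add_le_add (mul_le_mul_of_nonneg_left (add_le_add_right (add_le_add ?_ ?_) _) hb2) ?_
  · exact mul_le_mul_of_nonneg_left e2 hi2
  · exact mul_le_mul_of_nonneg_left e3 hi3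
  · exact mul_le_mul_of_nonneg_left (by linarith) hi4

theorem binExp_delta_le (hβ : β < 1) {d : ℝ} {n N : ℕ} (hd : 1 / 2 ≤ d) (hn : 0 < n)
    (hdn : d ≤ n) (hN : N ≤ n) (hq : 3 * d + 3 ≤ ((q : ℝ) - 1) / (1 - β)) :
    binExp (d / n) N (fun k => delta q β (2 + k)) ≤ meanBound d := by
  have hn' : (0 : ℝ) < n := Nat.cast_pos.2 hn
  have hp0 : 0 ≤ d / n := div_nonneg (by linarith) hn'.le
  have hp1 : d / n ≤ 1 := (div_le_one hn').2 hdn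
  refine (binExp_le_of_le hp0 hp1 (fun i j hij => delta_monotone hβ (by omega)) hN).trans ?_
  exact (binExp_mono hp0 hp1 n fun k => delta_two_add_le_quartic hβ hd hq k).trans
    (binExp_quartic_le (by linarith) hn hdn)

end ContractionFunction

/-! ### Splitting the weight of a walk into inner and leaving edges -/

section SelfAvoidingWalk

variable {V : Type*} [DecidableEq V]

/-- The edges of the walk `P`. -/
def walkEdges {ℓ : ℕ} (P : Fin (ℓ + 1) → V) : Finset (Sym2 V) :=
  Finset.univ.image fun i : Fin ℓ => s(P i.castSucc, P i.succ)

theorem card_walkEdges {ℓ : ℕ} {P : Fin (ℓ + 1) → V} (hP : Function.Injective P) :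
    #(walkEdges P) = ℓ := by
  rw [walkEdges, Finset.card_image_of_injective, Finset.card_fin]
  intro i j hij
  rcases Sym2.eq_iff.1 hij with ⟨-, h⟩ | ⟨h1, h2⟩
  · exact Fin.succ_injective _ (hP h)
  · have h1' := congrArg Fin.val (hP h1)
    have h2' := congrArg Fin.val (hP h2)
    simp at h1' h2'
    omega

theorem card_walkEdges_incident_le {ℓ : ℕ} {P : Fin (ℓ + 1) → V} (hP : Function.Injective P)
    (k : Fin (ℓ + 1)) : #{e ∈ walkEdges P | P k ∈ e} ≤ 2 := by
  have hsub : {e ∈ walkEdges P | P k ∈ e} ⊆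
      (({j | j.succ = k} : Finset (Fin ℓ)) ∪ ({j | j.castSucc = k} : Finset (Fin ℓ))).image
        fun i : Fin ℓ => s(P i.castSucc, P i.succ) := by
    intro e he
    obtain ⟨he, hk⟩ := Finset.mem_filter.1 he
    obtain ⟨j, -, rfl⟩ := Finset.mem_image.1 he
    refine Finset.mem_image_of_mem _ ?_
    rcases Sym2.mem_iff.1 hk with h | h
    · simp [hP h]
    · simp [hP h]
  refine (Finset.card_le_card hsub).trans (Finset.card_image_le.trans
    ((Finset.card_union_le _ _).trans (Nat.add_le_add (b := 1) (d := 1) ?_ ?_)))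
  · refine Finset.card_le_one.2 fun a ha b hb => Fin.succ_injective _ ?_
    rw [(Finset.mem_filter.1 ha).2, (Finset.mem_filter.1 hb).2]
  · refine Finset.card_le_one.2 fun a ha b hb => Fin.castSucc_injective _ ?_
    rw [(Finset.mem_filter.1 ha).2, (Finset.mem_filter.1 hb).2]

variable [Fintype V]

/-- The pairs joining `v` to a vertex outside `S`. -/
def outerPairs (S : Finset V) (v : V) : Finset (Sym2 V) :=
  (Finset.univ \ S).image fun w => s(v, w)

theorem card_outerPairs_le (S : Finset V) (v : V) : #(outerPairs S v) ≤ Fintype.card V :=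
  Finset.card_image_le.trans (Finset.card_le_univ _)

theorem outerPairs_subset {S : Finset V} {v : V} (hv : v ∈ S) :
    outerPairs S v ⊆ vertexPairs V \ innerPairs S := by
  intro e he
  obtain ⟨w, hw, rfl⟩ := Finset.mem_image.1 he
  have hwS := (Finset.mem_sdiff.1 hw).2
  refine Finset.mem_sdiff.2 ⟨mk_mem_vertexPairs.2 fun h => hwS (h ▸ hv), fun h => ?_⟩
  exact hwS ((mem_innerPairs.1 h).2 w (Sym2.mem_mk_right v w))

theorem disjoint_outerPairs {S : Finset V} {u v : V} (hu : u ∈ S) (huv : u ≠ v) :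
    Disjoint (outerPairs S u) (outerPairs S v) := by
  refine Finset.disjoint_left.2 fun e he he' => ?_
  obtain ⟨w, hw, rfl⟩ := Finset.mem_image.1 he
  obtain ⟨x, hx, hxw⟩ := Finset.mem_image.1 he'
  rcases Sym2.eq_iff.1 hxw with ⟨h, -⟩ | ⟨-, h⟩
  · exact huv h.symm
  · exact (Finset.mem_sdiff.1 hx).2 (h ▸ hu)

theorem card_incident_le_outer_add_inner (S : Finset V) {v : V} (hv : v ∈ S)
    {T K : Finset (Sym2 V)} (hT : T ⊆ vertexPairs V) :
    #{e ∈ T | v ∈ e} ≤ #{e ∈ K | v ∈ e} + #(T ∩ outerPairs S v) +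
      #{e ∈ (T ∩ innerPairs S) \ K | v ∈ e} := by
  have h : {e ∈ T | v ∈ e} ⊆ ({e ∈ K | v ∈ e} ∪ (T ∩ outerPairs S v)) ∪
      {e ∈ (T ∩ innerPairs S) \ K | v ∈ e} := by
    intro e he
    obtain ⟨heT, hve⟩ := Finset.mem_filter.1 he
    by_cases heK : e ∈ K
    · exact Finset.mem_union_left _ (Finset.mem_union_left _ (Finset.mem_filter.2 ⟨heK, hve⟩))
    obtain ⟨w, rfl⟩ := hve
    by_cases hw : w ∈ S
    · refine Finset.mem_union_right _ (Finset.mem_filter.2 ⟨Finset.mem_sdiff.2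
        ⟨Finset.mem_inter.2 ⟨heT, mem_innerPairs.2 ⟨hT heT, ?_⟩⟩, heK⟩, Sym2.mem_mk_left v w⟩)
      intro x hx
      rcases Sym2.mem_iff.1 hx with rfl | rfl
      · exact hv
      · exact hw
    · refine Finset.mem_union_left _ (Finset.mem_union_right _ (Finset.mem_inter.2 ⟨heT, ?_⟩))
      exact Finset.mem_image_of_mem _ (Finset.mem_sdiff.2 ⟨Finset.mem_univ _, hw⟩)
  exact (Finset.card_le_card h).trans ((Finset.card_union_le _ _).trans
    (Nat.add_le_add_right (Finset.card_union_le _ _) _))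

open Classical in
/-- The weight of a self-avoiding walk is at most a function of the edges inside the walk times
a product over the vertices of functions of the edges leaving the walk. -/
theorem saw_weight_le {q : ℕ} {β : ℝ} (hβ : β < 1) {ℓ : ℕ} {P : Fin (ℓ + 1) → V}
    (hP : Function.Injective P) {T : Finset (Sym2 V)} (hT : T ⊆ vertexPairs V) :
    (if IsPath (SimpleGraph.fromEdgeSet (T : Set (Sym2 V))) P then
      ∏ i : Fin ℓ, delta q β ((SimpleGraph.fromEdgeSet (T : Set (Sym2 V))).degree (P i.succ))
      else 0) ≤
    (if walkEdges P ⊆ T ∩ innerPairs (Finset.univ.image P) then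
      ∏ e ∈ T ∩ innerPairs (Finset.univ.image P), (if e ∈ walkEdges P then 1 else 9 / 4) else 0) *
    ∏ i : Fin ℓ, delta q β (2 + #(T ∩ outerPairs (Finset.univ.image P) (P i.succ))) := by
  have hδ0 : ∀ k, 0 ≤ delta q β k := fun k => (delta_pos hβ k).le
  set S := Finset.univ.image P with hS
  have hPS : ∀ i, P i ∈ S := fun i => Finset.mem_image_of_mem _ (Finset.mem_univ i)
  by_cases hpath : IsPath (SimpleGraph.fromEdgeSet (T : Set (Sym2 V))) P
  swap
  · rw [if_neg hpath]
    refine mul_nonneg ?_ (Finset.prod_nonneg fun i _ => hδ0 _)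
    split_ifs
    · exact Finset.prod_nonneg fun e _ => by split_ifs <;> norm_num
    · exact le_rfl
  have hK : walkEdges P ⊆ T ∩ innerPairs S := by
    intro e he
    obtain ⟨j, -, rfl⟩ := Finset.mem_image.1 he
    have hj := (adj_fromEdgeSet hT).1 (hpath.2 j)
    refine Finset.mem_inter.2 ⟨hj, mem_innerPairs.2 ⟨hT hj, fun v hv => ?_⟩⟩
    rcases Sym2.mem_iff.1 hv with rfl | rfl <;> exact hPS _
  rw [if_pos hpath, if_pos hK]
  -- `R` is the set of chords. Each meets at most two walk vertices, so it contributes at most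
  -- `(3/2) ^ 2 = 9/4`.
  set R := (T ∩ innerPairs S) \ walkEdges P with hR
  have hdeg : ∀ i : Fin ℓ, delta q β
      ((SimpleGraph.fromEdgeSet (T : Set (Sym2 V))).degree (P i.succ)) ≤
      (3 / 2) ^ #{e ∈ R | P i.succ ∈ e} * delta q β (2 + #(T ∩ outerPairs S (P i.succ))) := by
    intro i
    refine le_trans (delta_monotone hβ ?_) (delta_add_le hβ _ _)
    rw [degree_fromEdgeSet hT]
    have h := card_incident_le_outer_add_inner S (hPS i.succ) (K := walkEdges P) hT
    rw [← hR] at h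
    have := card_walkEdges_incident_le hP i.succ
    omega
  have hprod : ∏ e ∈ T ∩ innerPairs S, (if e ∈ walkEdges P then (1 : ℝ) else 9 / 4) =
      (9 / 4) ^ #R := by
    rw [← Finset.prod_sdiff hK, ← hR, Finset.prod_congr rfl fun e he =>
      if_neg (Finset.mem_sdiff.1 he).2, Finset.prod_const,
      Finset.prod_eq_one fun e he => if_pos he, mul_one]
  have hsum : ∑ i : Fin ℓ, #{e ∈ R | P i.succ ∈ e} ≤ 2 * #R := by
    have h := sum_card_incident (Finset.univ.image fun i : Fin ℓ => P i.succ) R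
    rw [Finset.sum_image fun i _ j _ hij => Fin.succ_injective _ (hP hij)] at h
    rw [h, mul_comm]
    exact Finset.sum_le_card_nsmul _ _ _ fun e _ => card_incident_le_two _ e
  calc _ ≤ ∏ i : Fin ℓ, (3 / 2 : ℝ) ^ #{e ∈ R | P i.succ ∈ e} *
        delta q β (2 + #(T ∩ outerPairs S (P i.succ))) :=
        Finset.prod_le_prod (fun i _ => hδ0 _) fun i _ => hdeg i
    _ = (3 / 2 : ℝ) ^ (∑ i : Fin ℓ, #{e ∈ R | P i.succ ∈ e}) *
        ∏ i : Fin ℓ, delta q β (2 + #(T ∩ outerPairs S (P i.succ))) := by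
        rw [Finset.prod_mul_distrib, Finset.prod_pow_eq_pow_sum]
    _ ≤ _ := by
        refine mul_le_mul_of_nonneg_right ?_ (Finset.prod_nonneg fun i _ => hδ0 _)
        rw [hprod, show (9 / 4 : ℝ) = (3 / 2) ^ 2 by norm_num, ← pow_mul]
        exact pow_le_pow_right₀ (by norm_num) hsum

end SelfAvoidingWalk

/-! ### The first moment of the walk sum -/

section ExpectedSum

variable {q : ℕ} {β d : ℝ} {n : ℕ}

open Classical in
-- Pairs inside the walk are independent of the pairs leaving it. The former give the presence
-- probability and the chord exponential; the latter give one factor `meanBound d` per vertex after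
-- the start.
theorem bernExp_saw_weight_le (hβ : β < 1) (hd : 1 / 2 ≤ d) (hn : 0 < n) (hdn : d ≤ n)
    (hq : 3 * d + 3 ≤ ((q : ℝ) - 1) / (1 - β)) {ℓ : ℕ} {P : Fin (ℓ + 1) → Fin n}
    (hP : Function.Injective P) :
    bernExp (d / n) (vertexPairs (Fin n)) (fun T =>
      if IsPath (SimpleGraph.fromEdgeSet (T : Set (Sym2 (Fin n)))) P then
      ∏ i : Fin ℓ, delta q β ((SimpleGraph.fromEdgeSet (T : Set (Sym2 (Fin n)))).degree (P i.succ))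
      else 0) ≤
    (d / n) ^ ℓ * Real.exp (d / n * (ℓ + 1) ^ 2) * meanBound d ^ ℓ := by
  have hn' : (0 : ℝ) < n := Nat.cast_pos.2 hn
  have hp0 : 0 ≤ d / n := div_nonneg (by linarith) hn'.le
  have hp1 : d / n ≤ 1 := (div_le_one hn').2 hdn
  set S := Finset.univ.image P with hS
  have hPS : ∀ i, P i ∈ S := fun i => Finset.mem_image_of_mem _ (Finset.mem_univ i)
  set C := innerPairs S with hC
  set x : Sym2 (Fin n) → ℝ := fun e => if e ∈ walkEdges P then 1 else 9 / 4 with hx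
  set F : Finset (Sym2 (Fin n)) → ℝ := fun T =>
    if walkEdges P ⊆ T then ∏ e ∈ T, x e else 0 with hF
  set H : Finset (Sym2 (Fin n)) → ℝ := fun T =>
    ∏ i : Fin ℓ, delta q β (2 + #(T ∩ outerPairs S (P i.succ))) with hH
  have hCV : C ⊆ vertexPairs (Fin n) := innerPairs_subset S
  have hKC : walkEdges P ⊆ C := by
    intro e he
    obtain ⟨j, -, rfl⟩ := Finset.mem_image.1 he
    refine mem_innerPairs.2 ⟨mk_mem_vertexPairs.2 fun h => ?_, fun v hv => ?_⟩
    · exact (Fin.castSucc_lt_succ (i := j)).ne (hP h)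
    · rcases Sym2.mem_iff.1 hv with rfl | rfl <;> exact hPS _
  have h1 : bernExp (d / n) C F ≤ (d / n) ^ ℓ * Real.exp (d / n * (ℓ + 1) ^ 2) := by
    have hx1 : ∀ e, 1 ≤ x e := fun e => by
      simp only [hx]
      split_ifs <;> norm_num
    refine (bernExp_prod_le hp0 hKC hx1).trans ?_
    rw [card_walkEdges hP, Finset.prod_eq_one fun e he => if_pos he, mul_one]
    refine mul_le_mul_of_nonneg_left (Real.exp_le_exp.2 (mul_le_mul_of_nonneg_left ?_ hp0))
      (pow_nonneg hp0 _)
    have h2 := two_mul_card_innerPairs_le S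
    have hcard : #S = ℓ + 1 := by
      rw [hS, Finset.card_image_of_injective _ hP, Finset.card_fin]
    rw [hcard] at h2
    have h3 : 2 * (#C : ℝ) ≤ (ℓ + 1) ^ 2 := by exact_mod_cast h2
    have h4 : ∑ e ∈ C, (x e - 1) ≤ #C • (5 / 4 : ℝ) :=
      Finset.sum_le_card_nsmul _ _ _ fun e _ => by
        simp only [hx]
        split_ifs <;> norm_num
    rw [nsmul_eq_mul] at h4
    nlinarith [sq_nonneg ((ℓ : ℝ) + 1)]
  have h2 : bernExp (d / n) (vertexPairs (Fin n) \ C) H ≤ meanBound d ^ ℓ := by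
    rw [hH, bernExp_prod_card (d / n) (fun k => delta q β (2 + k))
      (fun i : Fin ℓ => outerPairs S (P i.succ)) Finset.univ
      (fun i _ => outerPairs_subset (hPS _))
      (fun i _ j _ hij => disjoint_outerPairs (hPS _)
        fun h => hij (Fin.succ_injective _ (hP h)))]
    refine (Finset.prod_le_prod (fun i _ => ?_) fun i _ => binExp_delta_le hβ hd hn hdn
      ((card_outerPairs_le _ _).trans_eq (Fintype.card_fin n)) hq).trans ?_
    · rw [← bernExp_card]
      exact bernExp_nonneg hp0 hp1 fun T _ => (delta_pos hβ _).le
    · simp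
  have hH0 : 0 ≤ bernExp (d / n) (vertexPairs (Fin n) \ C) H :=
    bernExp_nonneg hp0 hp1 fun T _ => Finset.prod_nonneg fun i _ => (delta_pos hβ _).le
  calc _ ≤ bernExp (d / n) (vertexPairs (Fin n)) (fun T =>
        F (T ∩ C) * H (T ∩ (vertexPairs (Fin n) \ C))) := by
        refine bernExp_mono hp0 hp1 fun T hT => (saw_weight_le hβ hP hT).trans_eq ?_
        simp only [hF, hH, hC, hS]
        congr 1
        refine Finset.prod_congr rfl fun i _ => ?_
        rw [Finset.inter_assoc, Finset.inter_eq_right.2 (outerPairs_subset (hPS i.succ))]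
    _ = bernExp (d / n) C F * bernExp (d / n) (vertexPairs (Fin n) \ C) H := by
        rw [← bernExp_union_mul _ Finset.disjoint_sdiff, Finset.union_sdiff_of_subset hCV]
    _ ≤ _ := mul_le_mul h1 h2 hH0 (by positivity)

theorem card_injective_walks_le (v : Fin n) (ℓ : ℕ) :
    #{P : Fin (ℓ + 1) → Fin n | P 0 = v ∧ Function.Injective P} ≤ n ^ ℓ := by
  have h : #({P : Fin (ℓ + 1) → Fin n | P 0 = v ∧ Function.Injective P}) ≤
      #(Finset.univ : Finset (Fin ℓ → Fin n)) := by
    refine Finset.card_le_card_of_injOn Fin.tail (fun _ _ => Finset.mem_univ _) ?_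
    intro P hP Q hQ hPQ
    have hP' := (Finset.mem_filter.1 (Finset.mem_coe.1 hP)).2.1
    have hQ' := (Finset.mem_filter.1 (Finset.mem_coe.1 hQ)).2.1
    rw [← Fin.cons_self_tail P, ← Fin.cons_self_tail Q, hPQ, hP', hQ']
  simpa using h

/-- The first moment bound for the sum over self-avoiding walks. -/
theorem bernExp_sawSum_le (hβ : β < 1) (hd : 1 / 2 ≤ d) (hn : 0 < n) (hdn : d ≤ n)
    (hq : 3 * d + 3 ≤ ((q : ℝ) - 1) / (1 - β)) (v : Fin n) (ℓ : ℕ) :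
    bernExp (d / n) (vertexPairs (Fin n)) (fun T =>
      sawSum (delta q β) (SimpleGraph.fromEdgeSet (T : Set (Sym2 (Fin n)))) v ℓ) ≤
    Real.exp (d / n * (ℓ + 1) ^ 2) * (d * meanBound d) ^ ℓ := by
  classical
  have hn' : (0 : ℝ) < n := Nat.cast_pos.2 hn
  have h1 : ∀ G : SimpleGraph (Fin n), sawSum (delta q β) G v ℓ =
      ∑ P ∈ ({P : Fin (ℓ + 1) → Fin n | P 0 = v ∧ Function.Injective P} : Finset _),
        if IsPath G P then ∏ i : Fin ℓ, delta q β (G.degree (P i.succ)) else 0 := by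
    intro G
    rw [← Finset.sum_filter, Finset.filter_filter, sawSum, SAW]
    refine Finset.sum_congr ?_ fun P _ => ?_
    · ext P
      simp only [Finset.mem_filter, Finset.mem_univ, true_and]
      exact ⟨fun h => ⟨⟨h.1, h.2.1⟩, h.2⟩, fun h => ⟨h.1.1, h.2⟩⟩
    · refine Finset.prod_congr rfl fun i _ => ?_
      congr!
  simp_rw [h1]
  rw [bernExp_sum]
  have hnn : 0 ≤ (d / n) ^ ℓ * Real.exp (d / n * (ℓ + 1) ^ 2) * meanBound d ^ ℓ := by
    have := meanBound_pos (d := d) (by linarith)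
    have : 0 ≤ d / n := div_nonneg (by linarith) hn'.le
    positivity
  refine (Finset.sum_le_card_nsmul _ _
    ((d / n) ^ ℓ * Real.exp (d / n * (ℓ + 1) ^ 2) * meanBound d ^ ℓ) fun P hP => ?_).trans ?_
  · refine (bernExp_congr _ fun T _ => ?_).trans_le
      (bernExp_saw_weight_le hβ hd hn hdn hq (Finset.mem_filter.1 hP).2.2)
    congr!
  · rw [nsmul_eq_mul]
    refine (mul_le_mul_of_nonneg_right (Nat.cast_le.2 (card_injective_walks_le v ℓ)) hnn).trans_eq
      ?_
    push_cast
    rw [div_pow, mul_pow]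
    field_simp

end ExpectedSum

/-! ### High-probability bound for the walk sums -/

section SawProbability

variable {q : ℕ} {β d : ℝ}

theorem sawSum_nonneg (hβ : β < 1) {V : Type*} [Fintype V] (G : SimpleGraph V) (v : V) (ℓ : ℕ) :
    0 ≤ sawSum (delta q β) G v ℓ :=
  Finset.sum_nonneg fun _ _ => Finset.prod_nonneg fun _ _ => (delta_pos hβ _).le

/-- Markov's inequality and a union bound over the `n * (L + 1) ≤ 2 * n ^ 2` pairs `(v, ℓ)`; the
exponent 3 leaves `1 / n`. -/
theorem one_sub_gnp_sawSum_le (hβ : β < 1) (hd : 1 / 2 ≤ d)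
    (hq : 3 * d + 3 ≤ ((q : ℝ) - 1) / (1 - β)) {n L : ℕ} (hn : 0 < n) (hdn : d ≤ n)
    (hL : ((L : ℝ) + 1) ^ 2 ≤ 4 * n) :
    1 - (gnp n d).real {G | ∀ v : Fin n, ∀ ℓ : ℕ, ℓ ≤ L →
      sawSum (delta q β) G v ℓ < (n : ℝ) ^ (3 : ℝ) * (d * meanBound d) ^ ℓ} ≤
      2 * Real.exp (4 * d) * (1 / n) := by
  have hn' : (0 : ℝ) < n := Nat.cast_pos.2 hn
  have hn1 : (1 : ℝ) ≤ n := by exact_mod_cast hn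
  have hd0 : 0 < d := by linarith
  have hγ : 0 < d * meanBound d := mul_pos hd0 (meanBound_pos hd0)
  have hrpow : (n : ℝ) ^ (3 : ℝ) = (n : ℝ) ^ 3 := by
    rw [← Real.rpow_natCast]
    norm_num
  have hc : ∀ ℓ, 0 < ((n : ℝ) ^ 3 * (d * meanBound d) ^ ℓ)⁻¹ := fun ℓ => by positivity
  set W : Fin n × ℕ → Finset (Sym2 (Fin n)) → ℝ := fun x T =>
    ((n : ℝ) ^ 3 * (d * meanBound d) ^ x.2)⁻¹ *
      sawSum (delta q β) (SimpleGraph.fromEdgeSet (T : Set (Sym2 (Fin n)))) x.1 x.2 with hW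
  have hW0 : ∀ x T, 0 ≤ W x T := fun x T => mul_nonneg (hc _).le (sawSum_nonneg hβ _ _ _)
  refine (one_sub_gnp_real_le hn hd0.le hdn
    (W := fun T => ∑ x ∈ Finset.univ ×ˢ Finset.range (L + 1), W x T)
    (fun T _ => Finset.sum_nonneg fun x _ => hW0 x T) fun T _ hT => ?_).trans ?_
  · push Not at hT
    obtain ⟨v, ℓ, hℓ, h⟩ := hT
    have hmem : (v, ℓ) ∈ (Finset.univ : Finset (Fin n)) ×ˢ Finset.range (L + 1) := by
      simpa using Nat.lt_succ_of_le hℓ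
    refine le_trans ?_ (Finset.single_le_sum (f := fun x => W x T) (fun x _ => hW0 x T) hmem)
    rw [hrpow] at h
    simp only [hW]
    rw [inv_mul_eq_div]
    exact (one_le_div (by positivity)).2 h
  · rw [bernExp_sum]
    refine (Finset.sum_le_card_nsmul _ _ (Real.exp (4 * d) / (n : ℝ) ^ 3) fun x hx => ?_).trans ?_
    · have hx2 : x.2 ≤ L := by
        have := (Finset.mem_product.1 hx).2
        simpa [Nat.lt_succ_iff] using this
      simp only [hW]
      rw [bernExp_const_mul, inv_mul_le_iff₀ (by positivity)]
      refine (bernExp_sawSum_le hβ hd hn hdn hq x.1 x.2).trans ?_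
      have h1 : d / n * ((x.2 : ℝ) + 1) ^ 2 ≤ 4 * d := by
        have h2 : ((x.2 : ℝ) + 1) ^ 2 ≤ 4 * n := by
          refine le_trans ?_ hL
          gcongr
        calc d / n * ((x.2 : ℝ) + 1) ^ 2 ≤ d / n * (4 * n) := by gcongr
          _ = 4 * d := by field_simp
      have h3 : (n : ℝ) ^ 3 * (d * meanBound d) ^ x.2 * (Real.exp (4 * d) / (n : ℝ) ^ 3) =
          Real.exp (4 * d) * (d * meanBound d) ^ x.2 := by field_simp
      rw [h3]
      exact mul_le_mul_of_nonneg_right (Real.exp_le_exp.2 h1) (pow_nonneg hγ.le _)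
    · have hL2 : (L : ℝ) + 1 ≤ 2 * n := by
        refine abs_le_of_sq_le_sq' (a := (L : ℝ) + 1) ?_ (by positivity) |>.2
        nlinarith
      rw [nsmul_eq_mul, Finset.card_product, Finset.card_univ, Fintype.card_fin,
        Finset.card_range]
      push_cast
      calc (n : ℝ) * ((L : ℝ) + 1) * (Real.exp (4 * d) / (n : ℝ) ^ 3)
          ≤ (n : ℝ) * (2 * n) * (Real.exp (4 * d) / (n : ℝ) ^ 3) := by gcongr
        _ = 2 * Real.exp (4 * d) * (1 / n) := by field_simp

theorem eventually_sq_le_of_isLittleO_sqrt {L : ℕ → ℕ}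
    (hL : (fun n => (L n : ℝ)) =o[atTop] (fun n : ℕ => Real.sqrt (n : ℝ))) :
    ∀ᶠ n : ℕ in atTop, ((L n : ℝ) + 1) ^ 2 ≤ 4 * n := by
  filter_upwards [hL.bound one_pos, eventually_ge_atTop 1] with n h hn
  rw [Real.norm_of_nonneg (Nat.cast_nonneg _), Real.norm_of_nonneg (Real.sqrt_nonneg _),
    one_mul] at h
  have hn1 : (1 : ℝ) ≤ n := by exact_mod_cast hn
  have h1 : 1 ≤ Real.sqrt n := Real.one_le_sqrt.2 hn1
  have h2 := Real.sq_sqrt (Nat.cast_nonneg (α := ℝ) n)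
  have h3 : (L n : ℝ) + 1 ≤ 2 * Real.sqrt n := by linarith
  calc ((L n : ℝ) + 1) ^ 2 ≤ (2 * Real.sqrt (n : ℝ)) ^ 2 := by gcongr
    _ = 4 * (n : ℝ) := by rw [mul_pow, h2]; norm_num

theorem eventually_one_sub_gnp_sawSum_le (hβ : β < 1) (hd : 1 / 2 ≤ d)
    (hq : 3 * d + 3 ≤ ((q : ℝ) - 1) / (1 - β)) {L : ℕ → ℕ}
    (hL : (fun n => (L n : ℝ)) =o[atTop] (fun n : ℕ => Real.sqrt (n : ℝ))) :
    ∀ᶠ n : ℕ in atTop, 1 - (gnp n d).real {G | ∀ v : Fin n, ∀ ℓ : ℕ, ℓ ≤ L n →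
      sawSum (delta q β) G v ℓ < (n : ℝ) ^ (3 : ℝ) * (d * meanBound d) ^ ℓ} ≤
      2 * Real.exp (4 * d) * (1 / n) := by
  filter_upwards [eventually_sq_le_of_isLittleO_sqrt hL, eventually_gt_atTop 0,
    eventually_ge_atTop ⌈d⌉₊] with n h hn hdn
  exact one_sub_gnp_sawSum_le hβ hd hq hn (Nat.ceil_le.1 hdn) h

/-- The additive 4 pays for the 1 in `q - 1` and for `3 * (1 - β) ≤ 3`. -/
theorem three_mul_add_three_le (hβ0 : 0 ≤ β) (hβ : β < 1)
    (hq : 3 * (1 - β) * d + 4 < (q : ℝ)) : 3 * d + 3 ≤ ((q : ℝ) - 1) / (1 - β) := by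
  rw [le_div_iff₀ (sub_pos.2 hβ)]
  linarith

end SawProbability

/-! ### Breadth-first exploration of permissive blocks -/

section BlockExploration

variable {V : Type*}

/-- The parent functions of explorations: the first `ℓ` vertices after the root form a path, and
the remaining ones are attached in breadth-first order. -/
noncomputable def parentFunctions (ℓ m : ℕ) : Finset (Fin (ℓ + m) → Fin (ℓ + m + 1)) := by
  classical
  exact {π | (∀ i, π i ≤ i.castSucc) ∧ (∀ i : Fin (ℓ + m), i.val < ℓ → π i = i.castSucc) ∧
    ∀ i j : Fin (ℓ + m), ℓ ≤ i.val → i ≤ j → π i ≤ π j}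

/-- Adding `j` to the `j`-th parent after the path makes a monotone sequence strictly increasing,
hence determined by its range, a subset of `2 * (ℓ + m) + 1` integers. Without monotonicity the
count would be factorial and the union bound would fail. -/
theorem card_parentFunctions_le (ℓ m : ℕ) : #(parentFunctions ℓ m) ≤ 2 * 4 ^ (ℓ + m) := by
  classical
  have h : #(parentFunctions ℓ m) ≤ #((Finset.range (2 * (ℓ + m) + 1)).powerset) := by
    refine Finset.card_le_card_of_injOn
      (fun π => Finset.univ.image fun j : Fin m => (π (Fin.natAdd ℓ j)).val + j.val) ?_ ?_
    · intro π _
      refine Finset.mem_coe.2 (Finset.mem_powerset.2 fun x hx => ?_)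
      obtain ⟨j, -, rfl⟩ := Finset.mem_image.1 hx
      have := (π (Fin.natAdd ℓ j)).isLt
      have := j.isLt
      simp only [Finset.mem_range]
      omega
    · intro π hπ σ hσ h
      have hπ' := (Finset.mem_filter.1 (Finset.mem_coe.1 hπ)).2
      have hσ' := (Finset.mem_filter.1 (Finset.mem_coe.1 hσ)).2
      have hsm : ∀ τ : Fin (ℓ + m) → Fin (ℓ + m + 1),
          (∀ i j : Fin (ℓ + m), ℓ ≤ i.val → i ≤ j → τ i ≤ τ j) →
          StrictMono fun j : Fin m => (τ (Fin.natAdd ℓ j)).val + j.val := by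
        intro τ hτ i j hij
        have h1 : τ (Fin.natAdd ℓ i) ≤ τ (Fin.natAdd ℓ j) := by
          refine hτ _ _ (by simp) ?_
          rw [Fin.le_def]
          simpa using hij.le
        have h1' : (τ (Fin.natAdd ℓ i)).val ≤ (τ (Fin.natAdd ℓ j)).val := h1
        have h2 : i.val < j.val := hij
        change (τ (Fin.natAdd ℓ i)).val + i.val < (τ (Fin.natAdd ℓ j)).val + j.val
        omega
      have hr := ((hsm π hπ'.2.2).range_inj (hsm σ hσ'.2.2)).1 (by
        have := congrArg (fun s : Finset ℕ => (s : Set ℕ)) h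
        simpa using this)
      funext i
      rcases Nat.lt_or_ge i.val ℓ with hi | hi
      · rw [hπ'.2.1 i hi, hσ'.2.1 i hi]
      · have h3 := congrFun hr ⟨i.val - ℓ, by omega⟩
        have h4 : Fin.natAdd ℓ (⟨i.val - ℓ, by omega⟩ : Fin m) = i := by
          apply Fin.ext
          simp
          omega
        simp only [h4] at h3
        exact Fin.ext (by omega)
  refine h.trans_eq ?_
  rw [Finset.card_powerset, Finset.card_range, pow_succ, pow_mul]
  norm_num [mul_comm]

/-- The vertices attached by an exploration. -/
def attachedVertices [DecidableEq V] {ℓ m : ℕ} (u : Fin (ℓ + m + 1) → V) : Finset V :=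
  Finset.univ.image fun j : Fin m => u (Fin.natAdd ℓ j).succ

/-- The edges used by an exploration. -/
def explorationEdges [DecidableEq V] {N : ℕ} (u : Fin (N + 1) → V) (π : Fin N → Fin (N + 1)) :
    Finset (Sym2 V) :=
  Finset.univ.image fun i : Fin N => s(u i.succ, u (π i))

theorem card_attachedVertices [DecidableEq V] {ℓ m : ℕ} {u : Fin (ℓ + m + 1) → V}
    (hu : Function.Injective u) : #(attachedVertices u) = m := by
  rw [attachedVertices, Finset.card_image_of_injective, Finset.card_fin]
  intro i j hij
  exact Fin.natAdd_injective _ _ (Fin.succ_injective _ (hu hij))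

theorem card_explorationEdges [DecidableEq V] {N : ℕ} {u : Fin (N + 1) → V}
    {π : Fin N → Fin (N + 1)} (hu : Function.Injective u) (hπ : ∀ i, π i ≤ i.castSucc) :
    #(explorationEdges u π) = N := by
  rw [explorationEdges, Finset.card_image_of_injective, Finset.card_fin]
  intro i j hij
  rcases Sym2.eq_iff.1 hij with ⟨h, -⟩ | ⟨h1, h2⟩
  · exact Fin.succ_injective _ (hu h)
  · have h1' := congrArg Fin.val (hu h1)
    have h2' := congrArg Fin.val (hu h2)
    have h3 : (π i).val ≤ i.val := hπ i
    have h4 : (π j).val ≤ j.val := hπ j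
    simp only [Fin.val_succ] at h1' h2'
    omega

variable [Fintype V]

/-- Breadth-first exploration of the block of a path: if the block has at least `ℓ + 1 + m` vertices,
then the path is extended by `m` vertices `u (ℓ + 1), …, u (ℓ + m)` that are not of low degree, where
`u (i + 1)` is attached to `u (π i)` and `π` is monotone. -/
theorem exists_exploration {q : ℕ} {β : ℝ} {G : SimpleGraph V} {ℓ : ℕ} {P : Fin (ℓ + 1) → V}
    (hP : Function.Injective P) (m : ℕ)
    (hm : ℓ + 1 + m ≤ (permissiveBlock q β G (Set.range P)).ncard) :
    ∃ (u : ℕ → V) (π : ℕ → ℕ) (c : ℕ), (∀ k : Fin (ℓ + 1), u k = P k) ∧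
      Set.InjOn u (Set.Iic (ℓ + m)) ∧ (∀ i < ℓ, π i = i) ∧
      (∀ i, ℓ ≤ i → i < ℓ + m → π i ≤ i ∧ G.Adj (u (i + 1)) (u (π i)) ∧
        ¬ IsLowDegree q β G (u (i + 1)) ∧ π i ≤ c) ∧
      (∀ i j, ℓ ≤ i → i ≤ j → j < ℓ + m → π i ≤ π j) ∧
      ∀ k < c, ∀ w, ¬ IsLowDegree q β G w → G.Adj w (u k) → ∃ j ≤ ℓ + m, u j = w := by
  classical
  induction m with
  | zero =>
    refine ⟨fun k => if h : k < ℓ + 1 then P ⟨k, h⟩ else P 0, id, 0, fun k => dif_pos k.isLt, ?_,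
      fun i _ => rfl, fun i h1 h2 => by omega, fun i j h1 h2 h3 => by omega,
      fun k hk => by omega⟩
    intro i hi j hj hij
    have hi' : i < ℓ + 1 := Nat.lt_succ_of_le hi
    have hj' : j < ℓ + 1 := Nat.lt_succ_of_le hj
    simp only [hi', hj', dif_pos] at hij
    exact congrArg Fin.val (hP hij)
  | succ m ih =>
    obtain ⟨u, π, c, huP, hinj, hπ, hext, hmono, hc⟩ := ih (by omega)
    set U : Set V := u '' Set.Iic (ℓ + m) with hU
    have hPU : Set.range P ⊆ U := by
      rintro _ ⟨k, rfl⟩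
      exact ⟨k, by simp only [Set.mem_Iic]; omega, huP k⟩
    have hUcard : U.ncard = ℓ + m + 1 := by
      rw [hU, hinj.ncard_image, ← Finset.coe_Iic, Set.ncard_coe_finset, Nat.card_Iic]
    -- `U` contains the path but is smaller than its minimal permissive block.
    have hnot : ¬ IsPermissive q β G U := by
      intro h
      have hle := Set.ncard_le_ncard ((permissiveBlock_isLeast q β G (Set.range P)).2 ⟨hPU, h⟩)
      omega
    have hex : ∃ k ≤ ℓ + m, ∃ w ∉ U, ¬ IsLowDegree q β G w ∧ G.Adj w (u k) := by
      simp only [IsPermissive, not_forall] at hnot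
      obtain ⟨w, ⟨hwU, _, ⟨k, hk, rfl⟩, hadj⟩, hlow⟩ := hnot
      exact ⟨k, hk, w, hwU, hlow, hadj⟩
    -- Attaching at the earliest possible parent is the breadth-first rule. All vertices before `c`
    -- are exhausted, so `c ≤ k`, which keeps the parents monotone.
    set k := Nat.find hex with hk
    obtain ⟨hkm, w, hwU, hlow, hadj⟩ := Nat.find_spec hex
    rw [← hk] at hkm hadj
    have hck : c ≤ k := by
      by_contra! h
      obtain ⟨j, hj, hjw⟩ := hc k h w hlow hadj
      exact hwU ⟨j, hj, hjw⟩
    have hu' : ∀ i ≤ ℓ + m, Function.update u (ℓ + m + 1) w i = u i := fun i hi =>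
      Function.update_of_ne (by omega) _ _
    have hπ' : ∀ i < ℓ + m, Function.update π (ℓ + m) k i = π i := fun i hi =>
      Function.update_of_ne (by omega) _ _
    refine ⟨Function.update u (ℓ + m + 1) w, Function.update π (ℓ + m) k, k, ?_, ?_, ?_, ?_, ?_, ?_⟩
    · intro i
      rw [hu' i (by omega), huP]
    · have hIic : Set.Iic (ℓ + (m + 1)) = insert (ℓ + m + 1) (Set.Iic (ℓ + m)) := by
        ext i
        simp only [Set.mem_Iic, Set.mem_insert_iff]
        omega
      rw [hIic, Set.injOn_insert (by simp)]
      have heq : Set.EqOn (Function.update u (ℓ + m + 1) w) u (Set.Iic (ℓ + m)) :=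
        fun i hi => hu' i hi
      refine ⟨hinj.congr heq.symm, ?_⟩
      rw [heq.image_eq, Function.update_self]
      exact hwU
    · intro i hi
      rw [hπ' i (by omega), hπ i hi]
    · intro i h1 h2
      rcases Nat.lt_or_ge i (ℓ + m) with h | h
      · obtain ⟨a1, a2, a3, a4⟩ := hext i h1 h
        rw [hπ' i h, hu' (i + 1) (by omega), hu' (π i) (by omega)]
        exact ⟨a1, a2, a3, a4.trans hck⟩
      · obtain rfl : i = ℓ + m := by omega
        rw [Function.update_self, Function.update_self, hu' k hkm]
        exact ⟨hkm, hadj, hlow, le_rfl⟩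
    · intro i j h1 h2 h3
      rcases Nat.lt_or_ge j (ℓ + m) with h | h
      · rw [hπ' i (by omega), hπ' j h]
        exact hmono i j h1 h2 h
      · obtain rfl : j = ℓ + m := by omega
        rw [Function.update_self]
        rcases Nat.lt_or_ge i (ℓ + m) with h' | h'
        · rw [hπ' i h']
          exact ((hext i h1 h').2.2.2).trans hck
        · obtain rfl : i = ℓ + m := by omega
          rw [Function.update_self]
    · intro j hj x hx hxj
      rw [hu' j (by omega)] at hxj
      have hmin := Nat.find_min hex hj
      have hxU : x ∈ U := by
        by_contra h
        exact hmin ⟨by omega, x, h, hx, hxj⟩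
      obtain ⟨i, hi, rfl⟩ := hxU
      have hi' : i ≤ ℓ + m := hi
      exact ⟨i, by omega, hu' i hi'⟩

theorem exists_parentFunction [DecidableEq V] {q : ℕ} {β : ℝ} {G : SimpleGraph V} {ℓ : ℕ}
    {P : Fin (ℓ + 1) → V} (hP : IsPath G P) {m : ℕ}
    (hm : ℓ + 1 + m ≤ (permissiveBlock q β G (Set.range P)).ncard) :
    ∃ u : Fin (ℓ + m + 1) → V, Function.Injective u ∧ ∃ π ∈ parentFunctions ℓ m,
      (∀ i, G.Adj (u i.succ) (u (π i))) ∧ ∀ v ∈ attachedVertices u, ¬ IsLowDegree q β G v := by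
  classical
  obtain ⟨u, π, c, huP, hinj, hπ, hext, hmono, -⟩ := exists_exploration hP.1 m hm
  have hπi : ∀ i : Fin (ℓ + m), π i ≤ i := fun i => by
    rcases Nat.lt_or_ge i.val ℓ with hi | hi
    · exact (hπ i hi).le
    · exact (hext i hi i.isLt).1
  refine ⟨fun i => u i, fun i j hij => Fin.ext (hinj (Nat.lt_succ_iff.1 i.isLt)
    (Nat.lt_succ_iff.1 j.isLt) hij), fun i => ⟨π i, by have := hπi i; omega⟩,
    Finset.mem_filter.2 ⟨Finset.mem_univ _, fun i => hπi i, fun i hi => Fin.ext (hπ i hi),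
      fun i j hi hij => hmono i j hi hij j.isLt⟩, fun i => ?_, fun v hv => ?_⟩
  · rcases Nat.lt_or_ge i.val ℓ with hi | hi
    · have h := (hP.2 ⟨i, hi⟩).symm
      rw [← huP, ← huP] at h
      simpa [hπ i hi] using h
    · exact (hext i hi i.isLt).2.1
  · obtain ⟨j, -, rfl⟩ := Finset.mem_image.1 hv
    have h := (hext (ℓ + j) (by omega) (by omega)).2.2.1
    simpa using h

end BlockExploration

/-! ### Blocks of paths are small -/

section LocalSparsity

variable {q : ℕ} {β d : ℝ} {n : ℕ}

/-- The weight of an exploration: it is at least `1` if the exploration uses only pairs in `T` and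
all attached vertices have degree at least `2d - 3`. -/
noncomputable def explorationWeight (d : ℝ) {ℓ m : ℕ} (u : Fin (ℓ + m + 1) → Fin n)
    (π : Fin (ℓ + m) → Fin (ℓ + m + 1)) (T : Finset (Sym2 (Fin n))) : ℝ :=
  ((3 / 2 : ℝ) ^ (-(2 * d - 3))) ^ m * if explorationEdges u π ⊆ T then
    ∏ e ∈ T, (3 / 2 : ℝ) ^ #{v ∈ attachedVertices u | v ∈ e} else 0

theorem explorationWeight_nonneg {ℓ m : ℕ} (u : Fin (ℓ + m + 1) → Fin n)
    (π : Fin (ℓ + m) → Fin (ℓ + m + 1)) (T : Finset (Sym2 (Fin n))) :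
    0 ≤ explorationWeight d u π T := by
  unfold explorationWeight
  split_ifs <;> positivity

/-- By double counting, the product over edges has exponent equal to the degree sum of the attached
vertices, at least `m * (2 * d - 3)`. -/
theorem one_le_explorationWeight {ℓ m : ℕ} {u : Fin (ℓ + m + 1) → Fin n}
    (hu : Function.Injective u) {π : Fin (ℓ + m) → Fin (ℓ + m + 1)} {T : Finset (Sym2 (Fin n))}
    (hT : explorationEdges u π ⊆ T)
    (hdeg : ∀ v ∈ attachedVertices u, 2 * d - 3 ≤ #{e ∈ T | v ∈ e}) :
    1 ≤ explorationWeight d u π T := by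
  rw [explorationWeight, if_pos hT, Finset.prod_pow_eq_pow_sum, ← sum_card_incident,
    ← Finset.prod_pow_eq_pow_sum]
  have h : ((3 / 2 : ℝ) ^ (2 * d - 3)) ^ m ≤
      ∏ v ∈ attachedVertices u, (3 / 2 : ℝ) ^ #{e ∈ T | v ∈ e} := by
    refine (congrArg _ (card_attachedVertices hu).symm).trans_le ?_
    rw [← Finset.prod_const]
    refine Finset.prod_le_prod (fun v _ => by positivity) fun v hv => ?_
    rw [← Real.rpow_natCast]
    exact Real.rpow_le_rpow_of_exponent_le (by norm_num) (hdeg v hv)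
  refine le_trans (le_of_eq ?_) (mul_le_mul_of_nonneg_left h (by positivity))
  rw [← mul_pow, ← Real.rpow_add (by norm_num), neg_add_cancel, Real.rpow_zero, one_pow]

/-- Convexity: 5/8 is the slope of the chord from 0 to 2. -/
theorem three_halves_pow_sub_one_le {w : ℕ} (hw : w ≤ 2) :
    (3 / 2 : ℝ) ^ w - 1 ≤ 5 / 8 * w := by
  interval_cases w <;> norm_num

/-- The factor by which the expected weight of explorations shrinks with every attached vertex. -/
noncomputable def attachFactor (d : ℝ) : ℝ :=
  Real.exp (5 / 8 * d) * (3 / 2 : ℝ) ^ (-(2 * d - 3))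

theorem attachFactor_pos (d : ℝ) : 0 < attachFactor d := by
  unfold attachFactor
  positivity

/-- Each forced edge costs `d / n` times a tilt of at most 9/4. The `m` attached vertices have at
most `m * n` incidences with pairs, which gives `exp (5/8 * d)` per attached vertex. -/
theorem bernExp_explorationWeight_le (hd : 0 ≤ d) (hn : 0 < n) {ℓ m : ℕ}
    {u : Fin (ℓ + m + 1) → Fin n} (hu : Function.Injective u)
    {π : Fin (ℓ + m) → Fin (ℓ + m + 1)} (hπ : ∀ i, π i ≤ i.castSucc) :
    bernExp (d / n) (vertexPairs (Fin n)) (explorationWeight d u π) ≤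
      (d / n * (9 / 4)) ^ (ℓ + m) * attachFactor d ^ m := by
  have hn' : (0 : ℝ) < n := Nat.cast_pos.2 hn
  have hp0 : 0 ≤ d / n := by positivity
  set x : Sym2 (Fin n) → ℝ := fun e => (3 / 2 : ℝ) ^ #{v ∈ attachedVertices u | v ∈ e} with hx
  have hK : explorationEdges u π ⊆ vertexPairs (Fin n) := by
    intro e he
    obtain ⟨i, -, rfl⟩ := Finset.mem_image.1 he
    refine mk_mem_vertexPairs.2 fun h => ?_
    have h1 : i.val + 1 = (π i).val := congrArg Fin.val (hu h)
    have h2 : (π i).val ≤ i.val := hπ i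
    omega
  have hsum : ∑ e ∈ vertexPairs (Fin n), (x e - 1) ≤ 5 / 8 * (m * n) := by
    have h1 : ∑ e ∈ vertexPairs (Fin n), #{v ∈ attachedVertices u | v ∈ e} ≤ m * n := by
      rw [← sum_card_incident]
      refine (Finset.sum_le_card_nsmul _ _ _ fun v _ =>
        (card_vertexPairs_filter_mem_le v).trans_eq (Fintype.card_fin n)).trans_eq ?_
      rw [card_attachedVertices hu, smul_eq_mul]
    calc ∑ e ∈ vertexPairs (Fin n), (x e - 1)
        ≤ ∑ e ∈ vertexPairs (Fin n), 5 / 8 * (#{v ∈ attachedVertices u | v ∈ e} : ℝ) :=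
          Finset.sum_le_sum fun e _ => three_halves_pow_sub_one_le (card_incident_le_two _ e)
      _ = 5 / 8 * ((∑ e ∈ vertexPairs (Fin n), #{v ∈ attachedVertices u | v ∈ e} : ℕ) : ℝ) := by
          rw [← Finset.mul_sum, Nat.cast_sum]
      _ ≤ 5 / 8 * (m * n) := by
          refine mul_le_mul_of_nonneg_left ?_ (by norm_num)
          exact_mod_cast h1
  have hprod : ∏ e ∈ explorationEdges u π, x e ≤ (9 / 4) ^ (ℓ + m) := by
    refine (Finset.prod_le_prod (g := fun _ => (9 / 4 : ℝ)) (fun e _ => by positivity)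
      fun e _ => ?_).trans_eq
      (by rw [Finset.prod_const, card_explorationEdges hu hπ])
    calc x e ≤ (3 / 2 : ℝ) ^ 2 :=
          pow_le_pow_right₀ (by norm_num) (card_incident_le_two _ e)
      _ = 9 / 4 := by norm_num
  have hexp : Real.exp (d / n * ∑ e ∈ vertexPairs (Fin n), (x e - 1)) ≤
      Real.exp (5 / 8 * d) ^ m := by
    rw [← Real.exp_nat_mul, Real.exp_le_exp]
    calc d / n * ∑ e ∈ vertexPairs (Fin n), (x e - 1) ≤ d / n * (5 / 8 * (m * n)) := by gcongr
      _ = m * (5 / 8 * d) := by field_simp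
  unfold explorationWeight
  rw [bernExp_const_mul]
  have h := bernExp_prod_le hp0 hK (x := x) fun e => one_le_pow₀ (by norm_num)
  rw [card_explorationEdges hu hπ] at h
  calc _ ≤ ((3 / 2 : ℝ) ^ (-(2 * d - 3))) ^ m * ((d / n) ^ (ℓ + m) * (9 / 4) ^ (ℓ + m) *
        Real.exp (5 / 8 * d) ^ m) := by
        refine mul_le_mul_of_nonneg_left (h.trans ?_) (by positivity)
        gcongr
    _ = _ := by
        rw [attachFactor, mul_pow, mul_pow]
        ring

/-- The total weight of the explorations attaching `m` vertices to a path of length `ℓ`. -/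
noncomputable def explorationSum (d : ℝ) (n ℓ m : ℕ) (T : Finset (Sym2 (Fin n))) : ℝ :=
  ∑ x ∈ ({u | Function.Injective u} : Finset (Fin (ℓ + m + 1) → Fin n)) ×ˢ parentFunctions ℓ m,
    explorationWeight d x.1 x.2 T

theorem explorationSum_nonneg (ℓ m : ℕ) (T : Finset (Sym2 (Fin n))) :
    0 ≤ explorationSum d n ℓ m T :=
  Finset.sum_nonneg fun _ _ => explorationWeight_nonneg _ _ _

theorem explorationWeight_le_sum {ℓ m : ℕ} {u : Fin (ℓ + m + 1) → Fin n}
    (hu : Function.Injective u) {π : Fin (ℓ + m) → Fin (ℓ + m + 1)}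
    (hπ : π ∈ parentFunctions ℓ m) (T : Finset (Sym2 (Fin n))) :
    explorationWeight d u π T ≤ explorationSum d n ℓ m T := by
  have hmem : (u, π) ∈ ({u | Function.Injective u} : Finset (Fin (ℓ + m + 1) → Fin n)) ×ˢ
      parentFunctions ℓ m := by
    rw [Finset.mem_product, Finset.mem_filter]
    exact ⟨⟨Finset.mem_univ _, hu⟩, hπ⟩
  exact Finset.single_le_sum (f := fun x => explorationWeight d x.1 x.2 T)
    (fun _ _ => explorationWeight_nonneg _ _ _) hmem

/-- The `n ^ (ℓ + m + 1)` placements cancel all powers of `1 / n` but one factor `n`; the 9 is 4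
from the parent functions times 9/4 from the tilt. -/
theorem bernExp_explorationSum_le (hd : 0 ≤ d) (hn : 0 < n) (ℓ m : ℕ) :
    bernExp (d / n) (vertexPairs (Fin n)) (explorationSum d n ℓ m) ≤
      2 * n * (9 * d) ^ ℓ * (9 * d * attachFactor d) ^ m := by
  have hn' : (0 : ℝ) < n := Nat.cast_pos.2 hn
  have hκ := attachFactor_pos d
  unfold explorationSum
  rw [bernExp_sum]
  refine (Finset.sum_le_card_nsmul _ _ ((d / n * (9 / 4)) ^ (ℓ + m) * attachFactor d ^ m)
    fun x hx => ?_).trans ?_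
  · obtain ⟨h1, h2⟩ := Finset.mem_product.1 hx
    exact bernExp_explorationWeight_le hd hn (Finset.mem_filter.1 h1).2
      (Finset.mem_filter.1 h2).2.1
  · rw [nsmul_eq_mul, Finset.card_product]
    have h1 : #({u | Function.Injective u} : Finset (Fin (ℓ + m + 1) → Fin n)) ≤
        n ^ (ℓ + m + 1) := (Finset.card_le_univ _).trans_eq (by simp)
    have h2 : ((#({u | Function.Injective u} : Finset (Fin (ℓ + m + 1) → Fin n)) *
        #(parentFunctions ℓ m) : ℕ) : ℝ) ≤ (n : ℝ) ^ (ℓ + m + 1) * (2 * 4 ^ (ℓ + m)) := by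
      exact_mod_cast Nat.mul_le_mul h1 (card_parentFunctions_le ℓ m)
    refine (mul_le_mul_of_nonneg_right h2 (by positivity)).trans_eq ?_
    have h3 : d / n * (9 / 4) = (9 * d) * (1 / (n * 4)) := by field_simp
    rw [h3, mul_pow (9 * d), mul_pow (9 * d) (attachFactor d), div_pow, mul_pow (n : ℝ) 4,
      pow_add (9 * d), pow_succ, one_pow]
    field_simp

/-- The number of vertices attached to a path of length `ℓ` in the exploration argument. -/
noncomputable def attachCount (d : ℝ) (n ℓ : ℕ) : ℕ :=
  ⌈Real.log (9 * d) * ℓ + 3 * Real.log n⌉₊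

theorem le_ncard_of_lt {n : ℕ} (hd : 1 ≤ d) (hn : 3 ≤ n) {ℓ : ℕ} {b : ℕ}
    (hb : (Real.log (9 * d) + 6) * (ℓ + Real.log n) < b) : ℓ + 1 + attachCount d n ℓ ≤ b := by
  -- For `n ≥ 3` this lets `log n` absorb the root and the rounding of `attachCount`.
  have hlog : 1 ≤ Real.log n := by
    rw [Real.le_log_iff_exp_le (by positivity)]
    have h1 := Real.exp_one_lt_d9
    have h2 : (3 : ℝ) ≤ n := by exact_mod_cast hn
    linarith
  have hΛ : 0 ≤ Real.log (9 * d) := Real.log_nonneg (by linarith)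
  have hℓ : (0 : ℝ) ≤ ℓ := Nat.cast_nonneg _
  have h := Nat.ceil_lt_add_one (a := Real.log (9 * d) * ℓ + 3 * Real.log n)
    (by positivity)
  have h2 : ((ℓ + 1 + attachCount d n ℓ : ℕ) : ℝ) < b := by
    push_cast
    rw [attachCount]
    nlinarith [mul_nonneg hΛ (zero_le_one.trans hlog)]
  exact_mod_cast h2.le

/-- A gain of `exp (-1)` per attached vertex cancels the path cost `(9 * d) ^ ℓ` and yields `n ^
(-3)`; what remains can be summed over `ℓ < n`. -/
theorem attach_bound (hd : 1 ≤ d) (hd' : 9 * d * attachFactor d ≤ Real.exp (-1)) (hn : 0 < n)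
    (ℓ : ℕ) : 2 * n * (9 * d) ^ ℓ * (9 * d * attachFactor d) ^ attachCount d n ℓ ≤
      2 / (n : ℝ) ^ 2 := by
  have hn' : (0 : ℝ) < n := Nat.cast_pos.2 hn
  have hκ := attachFactor_pos d
  have h1 : (9 * d * attachFactor d) ^ attachCount d n ℓ ≤ ((9 * d) ^ ℓ * (n : ℝ) ^ 3)⁻¹ := by
    calc (9 * d * attachFactor d) ^ attachCount d n ℓ
        ≤ Real.exp (-1) ^ attachCount d n ℓ := by gcongr
      _ = Real.exp (-(attachCount d n ℓ : ℝ)) := by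
          rw [← Real.exp_nat_mul]
          ring_nf
      _ ≤ Real.exp (-(Real.log (9 * d) * ℓ + 3 * Real.log n)) :=
          Real.exp_le_exp.2 (neg_le_neg (Nat.le_ceil _))
      _ = ((9 * d) ^ ℓ * (n : ℝ) ^ 3)⁻¹ := by
          rw [Real.exp_neg, Real.exp_add, mul_comm (Real.log (9 * d)), Real.exp_nat_mul,
            Real.exp_log (by linarith), show (3 : ℝ) = ((3 : ℕ) : ℝ) by norm_num,
            Real.exp_nat_mul, Real.exp_log hn']
  refine (mul_le_mul_of_nonneg_left h1 (by positivity)).trans_eq ?_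
  have : 0 < (9 * d) ^ ℓ := by positivity
  field_simp

theorem one_sub_gnp_locallySparse_le (hd : 1 ≤ d)
    (hd' : 9 * d * attachFactor d ≤ Real.exp (-1))
    (hq : 2 * d - 3 ≤ ((q : ℝ) - 1) / (1 - β) - 2) (hn : 3 ≤ n) (hdn : d ≤ n) :
    1 - (gnp n d).real {G | LocallySparse q β (Real.log (9 * d) + 6) G} ≤ 2 * (1 / n) := by
  classical
  have hn0 : 0 < n := by omega
  have hn' : (0 : ℝ) < n := Nat.cast_pos.2 hn0
  have hd0 : 0 ≤ d := by linarith
  refine (one_sub_gnp_real_le hn0 hd0 hdn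
    (W := fun T => ∑ ℓ ∈ Finset.range n, explorationSum d n ℓ (attachCount d n ℓ) T)
    (fun T _ => Finset.sum_nonneg fun ℓ _ => explorationSum_nonneg _ _ _) fun T hT h => ?_).trans ?_
  · simp only [LocallySparse, not_forall, not_le, Fintype.card_fin] at h
    obtain ⟨ℓ, P, hP, hlt⟩ := h
    obtain ⟨u, hu, π, hπ, hadj, hhigh⟩ := exists_parentFunction hP (le_ncard_of_lt hd hn hlt)
    have hℓ : ℓ ∈ Finset.range n := by
      have := Fintype.card_le_of_injective P hP.1
      simp only [Fintype.card_fin] at this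
      exact Finset.mem_range.2 this
    have h1 : 1 ≤ explorationWeight d u π T := by
      refine one_le_explorationWeight hu (fun e he => ?_) fun v hv => ?_
      · obtain ⟨i, -, rfl⟩ := Finset.mem_image.1 he
        exact (adj_fromEdgeSet hT).1 (hadj i)
      · have h2 := hhigh v hv
        rw [IsLowDegree, not_lt, degree_fromEdgeSet hT] at h2
        exact hq.trans h2
    exact h1.trans ((explorationWeight_le_sum hu hπ T).trans (Finset.single_le_sum
      (f := fun ℓ => explorationSum d n ℓ (attachCount d n ℓ) T)
      (fun ℓ _ => explorationSum_nonneg _ _ _) hℓ))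
  · rw [bernExp_sum]
    refine (Finset.sum_le_card_nsmul _ _ (2 / (n : ℝ) ^ 2) fun ℓ _ =>
      (bernExp_explorationSum_le hd0 hn0 ℓ _).trans (attach_bound hd hd' hn0 ℓ)).trans_eq ?_
    rw [nsmul_eq_mul, Finset.card_range]
    field_simp

/-- Exponential decay in `d` beats the linear factor because the tilt 3/2 satisfies `2 * log (3/2) >
5/8`; numerically, `e ^ 5 < (3/2) ^ 16`. -/
theorem eventually_mul_attachFactor_le :
    ∀ᶠ d : ℝ in atTop, 9 * d * attachFactor d ≤ Real.exp (-1) := by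
  have ha : 0 < 2 * Real.log (3 / 2) - 5 / 8 := by
    have h : (5 / 16 : ℝ) < Real.log (3 / 2) := by
      rw [Real.lt_log_iff_exp_lt (by norm_num)]
      refine lt_of_pow_lt_pow_left₀ 16 (by norm_num) ?_
      rw [← Real.exp_nat_mul]
      calc Real.exp ((16 : ℕ) * (5 / 16)) = Real.exp 1 ^ 5 := by
            rw [← Real.exp_nat_mul]
            norm_num
        _ < 2.7182818286 ^ 5 := pow_lt_pow_left₀ Real.exp_one_lt_d9 (Real.exp_pos _).le (by norm_num)
        _ < (3 / 2) ^ 16 := by norm_num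
    linarith
  set a := 2 * Real.log (3 / 2) - 5 / 8 with ha'
  have heq : ∀ d : ℝ, 9 * d * attachFactor d =
      9 * (3 / 2) ^ (3 : ℝ) / a * ((a * d) ^ 1 * Real.exp (-(a * d))) := by
    intro d
    rw [attachFactor, neg_sub, Real.rpow_sub (by norm_num), Real.rpow_def_of_pos (by norm_num),
      Real.rpow_def_of_pos (by norm_num) (2 * d), show -(a * d) = 5 / 8 * d -
        Real.log (3 / 2) * (2 * d) by rw [ha']; ring, Real.exp_sub]
    field_simp
  have h := ((Real.tendsto_pow_mul_exp_neg_atTop_nhds_zero 1).comp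
    (tendsto_id.const_mul_atTop ha)).const_mul (9 * (3 / 2 : ℝ) ^ (3 : ℝ) / a)
  rw [mul_zero] at h
  filter_upwards [h.eventually (ge_mem_nhds (Real.exp_pos (-1)))] with d hd
  rw [heq]
  exact hd

/-- For large `d`, blocks of paths are small with probability `1 - O(1/n)`. -/
theorem exists_eventually_locallySparse : ∃ d₀ : ℝ, 1 ≤ d₀ ∧ ∀ d : ℝ, d₀ ≤ d →
    ∀ (q : ℕ) (β : ℝ), 2 * d - 3 ≤ ((q : ℝ) - 1) / (1 - β) - 2 →
    ∃ C : ℝ, 0 < C ∧ ∀ᶠ n : ℕ in atTop,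
      1 - (gnp n d).real {G | LocallySparse q β C G} ≤ 2 * (1 / n) := by
  obtain ⟨d₀, hd₀⟩ := eventually_atTop.1 eventually_mul_attachFactor_le
  refine ⟨max d₀ 1, le_max_right _ _, fun d hd q β hq => ⟨Real.log (9 * d) + 6, ?_, ?_⟩⟩
  · have : 0 ≤ Real.log (9 * d) := Real.log_nonneg (by linarith [le_max_right d₀ 1])
    linarith
  · filter_upwards [eventually_ge_atTop 3, eventually_ge_atTop ⌈d⌉₊] with n hn hdn
    exact one_sub_gnp_locallySparse_le ((le_max_right _ _).trans hd)
      (hd₀ d ((le_max_left _ _).trans hd)) hq hn (Nat.ceil_le.1 hdn)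

end LocalSparsity

/-! ### Colorability through the absence of dense vertex sets -/

section Coloring

/-- Greedy coloring: if every nonempty set of vertices contains a vertex with fewer than `q`
neighbors in the set, then the graph is `q`-colorable. -/
theorem colorable_of_forall_exists_card_lt {V : Type*} [Fintype V] [DecidableEq V]
    {G : SimpleGraph V} [DecidableRel G.Adj] {q : ℕ} (hq : 0 < q)
    (h : ∀ S : Finset V, S.Nonempty → ∃ v ∈ S, #{w ∈ S | G.Adj v w} < q) : G.Colorable q := by
  have key : ∀ S : Finset V, ∃ c : V → Fin q, ∀ u ∈ S, ∀ w ∈ S, G.Adj u w → c u ≠ c w := by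
    intro S
    induction S using Finset.strongInduction with
    | H S ih =>
      rcases S.eq_empty_or_nonempty with rfl | hS
      · exact ⟨fun _ => ⟨0, hq⟩, by simp⟩
      obtain ⟨v, hv, hcard⟩ := h S hS
      obtain ⟨c, hc⟩ := ih (S.erase v) (Finset.erase_ssubset hv)
      obtain ⟨a, ha⟩ : ∃ a : Fin q, a ∉ ({w ∈ S | G.Adj v w} : Finset V).image c := by
        by_contra! hall
        have h1 : #(Finset.univ : Finset (Fin q)) ≤ #({w ∈ S | G.Adj v w} : Finset V) :=
          (Finset.card_le_card fun a _ => hall a).trans Finset.card_image_le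
        rw [Finset.card_fin] at h1
        omega
      have hav : ∀ w ∈ S, G.Adj v w → c w ≠ a := fun w hw hvw hcw =>
        ha (Finset.mem_image.2 ⟨w, Finset.mem_filter.2 ⟨hw, hvw⟩, hcw⟩)
      refine ⟨Function.update c v a, fun u hu w hw huw => ?_⟩
      by_cases huv : u = v
      · subst huv
        rw [Function.update_self, Function.update_of_ne huw.ne']
        exact (hav w hw huw).symm
      · by_cases hwv : w = v
        · subst hwv
          rw [Function.update_self, Function.update_of_ne huv]
          exact hav u hu huw.symm
        · rw [Function.update_of_ne huv, Function.update_of_ne hwv]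
          exact hc u (Finset.mem_erase.2 ⟨huv, hu⟩) w (Finset.mem_erase.2 ⟨hwv, hw⟩) huw
  obtain ⟨c, hc⟩ := key Finset.univ
  exact ⟨SimpleGraph.Coloring.mk c fun {u w} huw =>
    hc u (Finset.mem_univ _) w (Finset.mem_univ _) huw⟩

variable {d : ℝ} {n : ℕ}

/-- The weight of a set of `s` vertices spanning `k` edges. -/
noncomputable def denseWeight (d : ℝ) (n s k : ℕ) : ℝ :=
  if s = 0 then 0 else (3 * n / s : ℝ) ^ k * Real.exp (-(3 / 2 * d * s * Real.log (3 * n / s)))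

theorem denseWeight_nonneg (s k : ℕ) : 0 ≤ denseWeight d n s k := by
  unfold denseWeight
  split_ifs <;> positivity

theorem one_le_denseWeight {s k : ℕ} (hs : s ≠ 0) (hsn : s ≤ n) (hk : 3 / 2 * d * s ≤ k) :
    1 ≤ denseWeight d n s k := by
  have hs' : (0 : ℝ) < s := Nat.cast_pos.2 (Nat.pos_of_ne_zero hs)
  have hsn' : (s : ℝ) ≤ n := by exact_mod_cast hsn
  have hl : 1 ≤ (3 * n / s : ℝ) := (one_le_div hs').2 (by linarith)
  have hl0 : 0 < (3 * n / s : ℝ) := by linarith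
  rw [denseWeight, if_neg hs]
  nth_rewrite 1 [← Real.exp_log hl0]
  rw [← Real.exp_nat_mul, ← Real.exp_add]
  refine Real.one_le_exp ?_
  have := mul_le_mul_of_nonneg_right hk (Real.log_nonneg hl)
  linarith

/-- The tilt `3 * n / #S` is chosen so that the bound `d / n * #S ^ 2 / 2` on the mean number of
inner edges becomes the required `3/2 * d * #S`. -/
theorem bernExp_denseWeight_le (hd : 0 ≤ d) (hn : 0 < n) {S : Finset (Fin n)} (hS : #S ≠ 0) :
    bernExp (d / n) (vertexPairs (Fin n)) (fun T => denseWeight d n #S #(T ∩ innerPairs S)) ≤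
      Real.exp (3 / 2 * d * #S * (1 - Real.log (3 * n / #S))) := by
  have hn' : (0 : ℝ) < n := Nat.cast_pos.2 hn
  have hs' : (0 : ℝ) < #S := Nat.cast_pos.2 (Nat.pos_of_ne_zero hS)
  have hsn : (#S : ℝ) ≤ n := by
    exact_mod_cast (Finset.card_le_univ S).trans_eq (Fintype.card_fin n)
  set l : ℝ := 3 * n / #S with hl
  have hl1 : 1 ≤ l := (one_le_div hs').2 (by linarith)
  set x : Sym2 (Fin n) → ℝ := fun e => if e ∈ innerPairs S then l else 1 with hx
  have hx1 : ∀ e, 1 ≤ x e := fun e => by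
    simp only [hx]
    split_ifs
    · exact hl1
    · exact le_rfl
  have h1 : ∀ T : Finset (Sym2 (Fin n)), denseWeight d n #S #(T ∩ innerPairs S) =
      Real.exp (-(3 / 2 * d * #S * Real.log l)) *
        if (∅ : Finset (Sym2 (Fin n))) ⊆ T then ∏ e ∈ T, x e else 0 := by
    intro T
    rw [denseWeight, if_neg hS, if_pos (Finset.empty_subset _), mul_comm]
    congr 1
    simp only [hx]
    rw [Finset.prod_ite_mem, Finset.prod_const]
  simp_rw [h1]
  rw [bernExp_const_mul]
  have h2 := bernExp_prod_le (p := d / n) (by positivity)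
    (Finset.empty_subset (vertexPairs (Fin n))) hx1
  rw [Finset.card_empty, pow_zero, Finset.prod_empty, one_mul, one_mul] at h2
  have h3 : d / n * ∑ e ∈ vertexPairs (Fin n), (x e - 1) ≤ 3 / 2 * d * #S := by
    have h4 : ∑ e ∈ vertexPairs (Fin n), (x e - 1) = #(innerPairs S) * (l - 1) := by
      have : ∀ e, x e - 1 = if e ∈ innerPairs S then l - 1 else 0 := fun e => by
        simp only [hx]
        split_ifs <;> ring
      simp_rw [this]
      rw [Finset.sum_ite_mem, Finset.inter_eq_right.2 (innerPairs_subset S), Finset.sum_const,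
        nsmul_eq_mul]
    have h5 : 2 * (#(innerPairs S) : ℝ) ≤ (#S : ℝ) ^ 2 := by
      exact_mod_cast two_mul_card_innerPairs_le S
    have h6 : (#(innerPairs S) : ℝ) * (l - 1) ≤ (#S : ℝ) ^ 2 / 2 * l := by
      have : (0 : ℝ) ≤ #(innerPairs S) := Nat.cast_nonneg _
      nlinarith
    rw [h4]
    calc d / n * (#(innerPairs S) * (l - 1)) ≤ d / n * ((#S : ℝ) ^ 2 / 2 * l) := by gcongr
      _ = 3 / 2 * d * #S := by
        rw [hl]
        field_simp
  calc _ ≤ Real.exp (-(3 / 2 * d * #S * Real.log l)) * Real.exp (3 / 2 * d * #S) :=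
        mul_le_mul_of_nonneg_left (h2.trans (Real.exp_le_exp.2 h3)) (Real.exp_pos _).le
    _ = _ := by
        rw [← Real.exp_add]
        ring_nf

theorem choose_le_exp {s : ℕ} (hs : s ≠ 0) (hn : 0 < n) :
    (n.choose s : ℝ) ≤ Real.exp (s * (1 + Real.log (n / s))) := by
  have hn' : (0 : ℝ) < n := Nat.cast_pos.2 hn
  have hs' : (0 : ℝ) < s := Nat.cast_pos.2 (Nat.pos_of_ne_zero hs)
  have h1 := Real.pow_div_factorial_le_exp (s : ℝ) hs'.le s
  calc (n.choose s : ℝ) ≤ (n : ℝ) ^ s / s.factorial := Nat.choose_le_pow_div s n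
    _ = (s : ℝ) ^ s / s.factorial * (n / s : ℝ) ^ s := by
        rw [div_pow]
        field_simp
    _ ≤ Real.exp s * (n / s : ℝ) ^ s := by gcongr
    _ = Real.exp (s * (1 + Real.log (n / s))) := by
        rw [mul_add, mul_one, Real.exp_add, Real.exp_nat_mul, Real.exp_log (by positivity)]

/-- For `s` near `n` everything rests on `log 3 > 1`. The margin 1/20 times `3/2 * 40` is 3, which
exceeds `1 + 2 * log 2`. Of the two factors `2 ^ (-s)` gained, one absorbs the `s` in `s / n` and
the other makes the sum over `s` converge. -/
theorem choose_mul_exp_le (hd : 40 ≤ d) {s : ℕ} (hs : s ≠ 0) (hsn : s ≤ n) :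
    (n.choose s : ℝ) * Real.exp (3 / 2 * d * s * (1 - Real.log (3 * n / s))) ≤
      1 / n * (1 / 2) ^ s := by
  have hs' : (0 : ℝ) < s := Nat.cast_pos.2 (Nat.pos_of_ne_zero hs)
  have hs1 : (1 : ℝ) ≤ s := by exact_mod_cast Nat.pos_of_ne_zero hs
  have hsn' : (s : ℝ) ≤ n := by exact_mod_cast hsn
  have hn' : (0 : ℝ) < n := by linarith
  have h3 : (21 / 20 : ℝ) ≤ Real.log 3 := by
    rw [Real.le_log_iff_exp_le (by norm_num)]
    refine le_of_pow_le_pow_left₀ (n := 20) (by norm_num) (by norm_num) ?_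
    rw [← Real.exp_nat_mul]
    calc Real.exp ((20 : ℕ) * (21 / 20)) = Real.exp 1 ^ 21 := by
          rw [← Real.exp_nat_mul]
          norm_num
      _ ≤ 2.7182818286 ^ 21 := pow_le_pow_left₀ (Real.exp_pos _).le Real.exp_one_lt_d9.le 21
      _ ≤ 3 ^ 20 := by norm_num
  have ht : 0 ≤ Real.log (n / s) := Real.log_nonneg ((one_le_div hs').2 hsn')
  have hlog : Real.log (3 * n / s) = Real.log 3 + Real.log (n / s) := by
    rw [mul_div_assoc, Real.log_mul (by norm_num) (by positivity)]
  have hl2 := Real.log_two_lt_d9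
  have hexp : s * (1 + Real.log (n / s)) + 3 / 2 * d * s * (1 - Real.log (3 * n / s)) ≤
      s * (-(Real.log 2)) + s * (-(Real.log 2)) + -Real.log (n / s) := by
    rw [hlog]
    have h4 : 1 + Real.log (n / s) + 3 / 2 * d * (1 - (Real.log 3 + Real.log (n / s))) ≤
        -(Real.log 2) + -(Real.log 2) + -Real.log (n / s) := by
      have : 3 / 2 * d * (1 / 20 + Real.log (n / s)) ≤
          3 / 2 * d * ((Real.log 3 - 1) + Real.log (n / s)) := by gcongr; linarith
      nlinarith
    nlinarith
  calc _ ≤ Real.exp (s * (1 + Real.log (n / s))) *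
        Real.exp (3 / 2 * d * s * (1 - Real.log (3 * n / s))) := by
        gcongr
        exact choose_le_exp hs (by omega)
    _ ≤ (1 / 2) ^ s * (1 / 2) ^ s * (s / n) := by
        rw [← Real.exp_add]
        refine (Real.exp_le_exp.2 hexp).trans_eq ?_
        rw [Real.exp_add, Real.exp_add, Real.exp_nat_mul, Real.exp_neg, Real.exp_log two_pos,
          Real.exp_neg, Real.exp_log (by positivity), inv_div, one_div]
    _ = 1 / n * (1 / 2) ^ s * (s / 2 ^ s) := by
        rw [div_pow, one_pow]
        field_simp
    _ ≤ 1 / n * (1 / 2) ^ s * 1 := by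
        gcongr
        rw [div_le_one (by positivity)]
        exact_mod_cast (Nat.lt_two_pow_self (n := s)).le
    _ = _ := mul_one _

theorem one_sub_gnp_colorable_le (hd : 40 ≤ d) (hn : 0 < n) (hdn : d ≤ n) {q : ℕ}
    (hq : 3 * d ≤ q) : 1 - (gnp n d).real {G | G.Colorable q} ≤ 2 * (1 / n) := by
  classical
  have hn' : (0 : ℝ) < n := Nat.cast_pos.2 hn
  have hd0 : 0 ≤ d := by linarith
  have hq0 : 0 < q := by
    have : (0 : ℝ) < q := by linarith
    exact_mod_cast this
  refine (one_sub_gnp_real_le hn hd0 hdn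
    (W := fun T => ∑ S ∈ (Finset.univ : Finset (Fin n)).powerset,
      denseWeight d n #S #(T ∩ innerPairs S))
    (fun T _ => Finset.sum_nonneg fun S _ => denseWeight_nonneg _ _) fun T hT h => ?_).trans ?_
  · obtain ⟨S, hS, hSq⟩ : ∃ S : Finset (Fin n), S.Nonempty ∧ ∀ v ∈ S,
        q ≤ #{w ∈ S | (SimpleGraph.fromEdgeSet (T : Set (Sym2 (Fin n)))).Adj v w} := by
      by_contra! hcon
      exact h (colorable_of_forall_exists_card_lt hq0 hcon)
    have h1 : ∀ v ∈ S, q ≤ #{e ∈ T ∩ innerPairs S | v ∈ e} := by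
      intro v hv
      refine (hSq v hv).trans (Finset.card_le_card_of_injOn (fun w => s(v, w)) ?_ ?_)
      · intro w hw
        obtain ⟨hwS, hvw⟩ := Finset.mem_filter.1 (Finset.mem_coe.1 hw)
        have hT' := (adj_fromEdgeSet hT).1 hvw
        refine Finset.mem_coe.2 (Finset.mem_filter.2 ⟨Finset.mem_inter.2 ⟨hT',
          mem_innerPairs.2 ⟨hT hT', fun x hx => ?_⟩⟩, Sym2.mem_mk_left v w⟩)
        rcases Sym2.mem_iff.1 hx with rfl | rfl
        · exact hv
        · exact hwS
      · intro w _ w' _ hww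
        exact Sym2.congr_right.1 hww
    have h2 : #S * q ≤ 2 * #(T ∩ innerPairs S) := by
      calc #S * q ≤ ∑ v ∈ S, #{e ∈ T ∩ innerPairs S | v ∈ e} := by
            rw [← smul_eq_mul]
            exact Finset.card_nsmul_le_sum _ _ _ h1
        _ = ∑ e ∈ T ∩ innerPairs S, #{v ∈ S | v ∈ e} := sum_card_incident _ _
        _ ≤ #(T ∩ innerPairs S) * 2 := Finset.sum_le_card_nsmul _ _ _ fun e _ =>
            card_incident_le_two _ e
        _ = 2 * #(T ∩ innerPairs S) := mul_comm _ _
    have h2' : (#S : ℝ) * q ≤ 2 * #(T ∩ innerPairs S) := by exact_mod_cast h2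
    refine le_trans (one_le_denseWeight (Finset.card_ne_zero.2 hS)
      ((Finset.card_le_univ S).trans_eq (Fintype.card_fin n)) ?_)
      (Finset.single_le_sum (f := fun S => denseWeight d n #S #(T ∩ innerPairs S))
        (fun S _ => denseWeight_nonneg _ _) (Finset.mem_powerset.2 (Finset.subset_univ S)))
    have : (0 : ℝ) ≤ #S := Nat.cast_nonneg _
    nlinarith
  · rw [bernExp_sum]
    set f : ℕ → ℝ := fun s => if s = 0 then 0 else
      Real.exp (3 / 2 * d * s * (1 - Real.log (3 * n / s))) with hf
    have h1 : ∀ S : Finset (Fin n), bernExp (d / n) (vertexPairs (Fin n))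
        (fun T => denseWeight d n #S #(T ∩ innerPairs S)) ≤ f #S := by
      intro S
      by_cases hS : #S = 0
      · simp only [hf, denseWeight, hS, if_true]
        exact (bernExp_const _ _ 0).le
      · simp only [hf, hS, if_false]
        exact bernExp_denseWeight_le hd0 hn hS
    refine (Finset.sum_le_sum fun S _ => h1 S).trans ?_
    rw [Finset.sum_powerset_apply_card, Finset.card_univ, Fintype.card_fin]
    calc ∑ s ∈ Finset.range (n + 1), n.choose s • f s
        ≤ ∑ s ∈ Finset.range (n + 1), 1 / n * (1 / 2 : ℝ) ^ s := by
          refine Finset.sum_le_sum fun s hs => ?_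
          have hsn : s ≤ n := Nat.lt_succ_iff.1 (Finset.mem_range.1 hs)
          rw [nsmul_eq_mul]
          by_cases h0 : s = 0
          · simp only [hf, h0, if_true, mul_zero]
            positivity
          · simp only [hf, h0, if_false]
            exact choose_mul_exp_le hd h0 hsn
      _ = 1 / n * ∑ s ∈ Finset.range (n + 1), (1 / 2 : ℝ) ^ s := by rw [Finset.mul_sum]
      _ ≤ 1 / n * 2 := by
          gcongr
          exact sum_geometric_two_le _
      _ = _ := mul_comm _ _

end Coloring

/-! ### Union bounds and passage to asymptotics -/

section Combination

theorem one_sub_gnp_and_le (n : ℕ) (d : ℝ) (A B : SimpleGraph (Fin n) → Prop) :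
    1 - (gnp n d).real {G | A G ∧ B G} ≤
      (1 - (gnp n d).real {G | A G}) + (1 - (gnp n d).real {G | B G}) := by
  have hm : ∀ s : Set (SimpleGraph (Fin n)), MeasurableSet s := fun s =>
    s.toFinite.measurableSet
  rw [← MeasureTheory.probReal_compl_eq_one_sub (hm _),
    ← MeasureTheory.probReal_compl_eq_one_sub (hm _),
    ← MeasureTheory.probReal_compl_eq_one_sub (hm _)]
  refine le_trans (le_of_eq (congrArg _ ?_)) (MeasureTheory.measureReal_union_le _ _)
  exact Set.compl_inter {G | A G} {G | B G}

theorem gnp_real_mono {n : ℕ} {d : ℝ} {A B : SimpleGraph (Fin n) → Prop} (h : ∀ G, A G → B G) :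
    (gnp n d).real {G | A G} ≤ (gnp n d).real {G | B G} :=
  MeasureTheory.measureReal_mono h

theorem isBigO_one_div_of_eventually_le {d K : ℝ} {Q : ∀ n : ℕ, SimpleGraph (Fin n) → Prop}
    (h : ∀ᶠ n : ℕ in atTop, 1 - (gnp n d).real {G | Q n G} ≤ K * (1 / n)) :
    (fun n : ℕ => 1 - (gnp n d).real {G | Q n G}) =O[atTop] (fun n : ℕ => 1 / (n : ℝ)) := by
  refine Asymptotics.IsBigO.of_bound K ?_
  filter_upwards [h] with n hn
  rwa [Real.norm_of_nonneg (sub_nonneg.2 MeasureTheory.measureReal_le_one),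
    Real.norm_of_nonneg (by positivity)]

theorem tendsto_gnp_real_one {d K : ℝ} {Q : ∀ n : ℕ, SimpleGraph (Fin n) → Prop}
    (h : ∀ᶠ n : ℕ in atTop, 1 - (gnp n d).real {G | Q n G} ≤ K * (1 / n)) :
    Tendsto (fun n : ℕ => (gnp n d).real {G | Q n G}) atTop (𝓝 1) := by
  have h1 : Tendsto (fun n : ℕ => 1 - K * (1 / (n : ℝ))) atTop (𝓝 1) := by
    simpa using (tendsto_one_div_atTop_nhds_zero_nat (𝕜 := ℝ)).const_mul K |>.const_sub 1
  refine tendsto_of_tendsto_of_tendsto_of_le_of_le' h1 tendsto_const_nhds ?_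
    (Eventually.of_forall fun n => MeasureTheory.measureReal_le_one)
  filter_upwards [h] with n hn
  linarith

end Combination

end PottsGnp

theorem mainTheorem5 :
    -- The theorem: the three properties hold simultaneously with probability `1 - o(1)`.
    (∃ d₀ : ℝ, ∀ d : ℝ, d₀ ≤ d → ∀ β : ℝ, 0 ≤ β → β < 1 →
      ∀ q : ℕ, 3 * (1 - β) * d + 4 < (q : ℝ) →
      ∃ C : ℝ, 0 < C ∧ ∃ γ : ℝ, 0 < γ ∧ γ < 1 ∧ ∃ C' : ℝ, 0 < C' ∧
        ∀ L : ℕ → ℕ, (fun n => (L n : ℝ)) =o[atTop] (fun n : ℕ => Real.sqrt (n : ℝ)) →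
          Tendsto
            (fun n : ℕ => (PottsGnp.gnp n d).real
              {G | (∀ v : Fin n, ∀ ℓ : ℕ, ℓ ≤ L n →
                      PottsGnp.sawSum (PottsGnp.delta q β) G v ℓ < (n : ℝ) ^ C * γ ^ ℓ) ∧
                   (β = 0 → G.Colorable q) ∧
                   PottsGnp.LocallySparse q β C' G})
            atTop (𝓝 1)) ∧
    -- The first property, for every `d > 1`, with probability `1 - O(1/n)`.
    (∀ d : ℝ, 1 < d → ∀ β : ℝ, 0 ≤ β → β < 1 →
      ∀ q : ℕ, 3 * (1 - β) * d + 4 < (q : ℝ) →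
      ∃ C : ℝ, 0 < C ∧ ∃ γ : ℝ, 0 < γ ∧ γ < 1 ∧
        ∀ L : ℕ → ℕ, (fun n => (L n : ℝ)) =o[atTop] (fun n : ℕ => Real.sqrt (n : ℝ)) →
          (fun n : ℕ => 1 - (PottsGnp.gnp n d).real
              {G | ∀ v : Fin n, ∀ ℓ : ℕ, ℓ ≤ L n →
                      PottsGnp.sawSum (PottsGnp.delta q β) G v ℓ ≤ (n : ℝ) ^ C * γ ^ ℓ})
            =O[atTop] (fun n : ℕ => 1 / (n : ℝ))) ∧
    -- The third property, under `q ≥ (2 + ε) d`, with probability `1 - O(1/n)`.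
    (∀ ε : ℝ, 0 < ε → ∃ d₀ : ℝ, ∀ d : ℝ, d₀ ≤ d →
      ∀ q : ℕ, (2 + ε) * d ≤ (q : ℝ) → ∀ β : ℝ, 0 ≤ β → β < 1 →
      ∃ C : ℝ, 0 < C ∧
        (fun n : ℕ => 1 - (PottsGnp.gnp n d).real
            {G | PottsGnp.LocallySparse q β C G})
          =O[atTop] (fun n : ℕ => 1 / (n : ℝ))) := by
  refine ⟨?_, ?_, ?_⟩
  · obtain ⟨d₀, hd₀1, hd₀⟩ := PottsGnp.exists_eventually_locallySparse
    refine ⟨max d₀ 40, fun d hd β hβ0 hβ q hq => ?_⟩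
    have hd1 : d₀ ≤ d := (le_max_left _ _).trans hd
    have hd40 : 40 ≤ d := (le_max_right _ _).trans hd
    have hQ := PottsGnp.three_mul_add_three_le hβ0 hβ hq
    obtain ⟨C', hC', hsparse⟩ := hd₀ d hd1 q β (by linarith)
    refine ⟨3, by norm_num, d * PottsGnp.meanBound d,
      mul_pos (by linarith) (PottsGnp.meanBound_pos (by linarith)),
      PottsGnp.mul_meanBound_lt_one (by linarith), C', hC', fun L hL => ?_⟩
    refine PottsGnp.tendsto_gnp_real_one (K := 2 * Real.exp (4 * d) + (2 + 2)) ?_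
    filter_upwards [PottsGnp.eventually_one_sub_gnp_sawSum_le hβ (by linarith) hQ hL, hsparse,
      eventually_gt_atTop 0, eventually_ge_atTop ⌈d⌉₊] with n hsaw hsp hn hdn
    have hcol : 1 - (PottsGnp.gnp n d).real {G | β = 0 → G.Colorable q} ≤ 2 * (1 / n) := by
      by_cases h0 : β = 0
      · refine le_trans ?_ (PottsGnp.one_sub_gnp_colorable_le (q := q) hd40 hn
          (Nat.ceil_le.1 hdn) (by rw [h0] at hq; linarith))
        exact sub_le_sub_left (PottsGnp.gnp_real_mono fun G hG _ => hG) 1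
      · have h1 : {G : SimpleGraph (Fin n) | β = 0 → G.Colorable q} = Set.univ :=
          Set.eq_univ_of_forall fun G h => absurd h h0
        rw [h1, MeasureTheory.probReal_univ, sub_self]
        positivity
    refine (PottsGnp.one_sub_gnp_and_le n d _ _).trans ?_
    rw [add_mul, add_mul]
    exact add_le_add hsaw ((PottsGnp.one_sub_gnp_and_le n d _ _).trans (add_le_add hcol hsp))
  · intro d hd β hβ0 hβ q hq
    refine ⟨3, by norm_num, d * PottsGnp.meanBound d,
      mul_pos (by linarith) (PottsGnp.meanBound_pos (by linarith)),
      PottsGnp.mul_meanBound_lt_one (by linarith), fun L hL => ?_⟩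
    refine PottsGnp.isBigO_one_div_of_eventually_le (K := 2 * Real.exp (4 * d)) ?_
    filter_upwards [PottsGnp.eventually_one_sub_gnp_sawSum_le hβ (by linarith)
      (PottsGnp.three_mul_add_three_le hβ0 hβ hq) hL] with n hsaw
    refine le_trans (sub_le_sub_left (PottsGnp.gnp_real_mono fun G hG v ℓ hℓ => ?_) 1) hsaw
    exact (hG v ℓ hℓ).le
  · intro ε hε
    obtain ⟨d₀, hd₀1, hd₀⟩ := PottsGnp.exists_eventually_locallySparse
    refine ⟨d₀, fun d hd q hq β hβ0 hβ => ?_⟩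
    -- Dividing by `1 - β ≤ 1` only helps, so `β = 0` is the worst case, with low-degree threshold
    -- `q - 3 ≥ 2 * d - 3`.
    have hQ : 2 * d - 3 ≤ ((q : ℝ) - 1) / (1 - β) - 2 := by
      have h1 : 0 ≤ ε * d := mul_nonneg hε.le (by linarith)
      have h2 : (q : ℝ) - 1 ≤ ((q : ℝ) - 1) / (1 - β) :=
        le_div_self (by linarith) (by linarith) (by linarith)
      linarith
    obtain ⟨C, hC, hsparse⟩ := hd₀ d hd q β hQ
    exact ⟨C, hC, PottsGnp.isBigO_one_div_of_eventually_le hsparse⟩
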